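/- Let $n\ge 1$ and let $\Sigma\subset\mathbb R^n$ be a closed (compact, without boundary) embedded hypersurface of class $C^k$, $k\ge 3$, that bounds a bounded domain $\Omega$, with outer unit normal $\nu_\Sigma$. By a chart we mean a $C^k$-diffeomorphism $\Phi$ between open subsets of $\mathbb R^n$ and of $\mathbb R^{n-1}\times\mathbb R$ such that $\Sigma\cap\operatorname{dom}\Phi=\Phi^{-1}(\mathbb R^{n-1}\times\{0\})$; it yields the local parametrization $\varphi(\theta)=\Phi^{-1}(\theta,0)$, $\theta\in\Theta$, where $\Theta=\{\theta:(\theta,0)\in\operatorname{im}\Phi\}$, the tangent vectors $\tau_i=\partial_i\varphi$, the first and second fundamental forms $g_{ij}=(\tau_i|\tau_j)$, $l_{ij}=(\partial_i\partial_j\varphi|\nu_\Sigma)$, $[g^{ij}]=[g_{ij}]^{-1}$, the dual basis $\tau^i=g^{ij}\tau_j$, the principal curvatures (the eigenvalues of $[g^{ir}l_{rj}]$), the mean curvature $g^{ij}l_{ij}$ (the sum of the principal curvatures), and the Weingarten tensor $L_\Sigma=l_{ij}\,\tau^i\otimes\tau^j$, where $[a\otimes b]x=(b|x)a$. For a scalar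 field $\rho$ and a vector field $f$ on $\Sigma$ let $\nabla_\Sigma\rho=\tau^i\partial_i\rho$ and $\nabla_\Sigma f=\tau^j\otimes\partial_j f$, where $\partial_j\rho=\partial_j(\rho\circ\varphi)$ and $\partial_jf=\partial_j(f\circ\varphi)$. Let $$\rho_0=\frac1{\sup\{|\kappa|:\kappa\text{ a principal curvature of }\Sigma\text{ at some point}\}}\in(0,\infty].$$ For $\rho\in C^2(\Sigma)$ with $|\rho|_\infty<\rho_0$ let $\Gamma_\rho$ be the hypersurface parametrized by $\psi_\rho(p)=p+\rho(p)\nu_\Sigma(p)$, $p\in\Sigma$; set $$M_0(\rho)=(I-\rho L_\Sigma)^{-1},\qquad a(\rho)=M_0(\rho)\nabla_\Sigma\rho,\qquad \beta(\rho)=(1+|a(\rho)|^2)^{-1/2}.$$ (i) For each such $\rho$, in each chart, $\psi_\rho\circ\varphi$ is of class $C^2$, $I-\rho L_\Sigma$ is invertible, $a(\rho)$ is of class $C^1$, the vectors $\tau^\Gamma_i=\partial_i(\psi_\rho\circ\varphi)$ are linearly independent, and there is exactly one unit vector $\nu^\Gamma$ with $(\nu^\Gamma|\tau_i^\Gamma)=0$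 for all $i$ and $(\nu^\Gamma|\nu_\Sigma)>0$. The mean curvature $\kappa(\rho)$ of $\Gamma_\rho$ at $\psi_\rho(p)$, computed with the normal $\nu^\Gamma$, is $$\kappa(\rho)=\beta(\rho)\big\{\operatorname{tr}\big[M_0(\rho)(L_\Sigma+\nabla_\Sigma a(\rho))\big]-\beta^2(\rho)\big(M_0(\rho)a(\rho)\,\big|\,[\nabla_\Sigma a(\rho)]a(\rho)\big)\big\}.$$ (ii) The operator $\rho\mapsto\kappa(\rho)$ is quasilinear of second order: in each chart, $$\kappa(\rho)=c^{ij}(\theta,\rho,\partial\rho)\,\partial_i\partial_j\rho+g(\theta,\rho,\partial\rho),\qquad c^{ij}=\beta(\rho)[M_0^2(\rho)]^{ij}-\beta^3(\rho)[M_0^2(\rho)\nabla_\Sigma\rho]^i[M_0^2(\rho)\nabla_\Sigma\rho]^j,$$ for all such $\rho$, where $[T]^{ij}=(\tau^i|T\tau^j)$ and $[u]^i=(u|\tau^i)$. Here $c^{ij}(\theta,s,v)$ is the given expression with $s$ in place of $\rho$ and $v_i\tau^i$ in place of $\nabla_\Sigma\rho$, the function $g$ does not depend on $\rho$ other than through its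 arguments, and $c^{ij}$ and $g$ are continuous on $\{(\theta,s,v):\theta\in\Theta,\ s\in\mathbb R,\ |s|<\rho_0,\ v\in\mathbb R^{n-1}\}$. (iii) The operator is strongly elliptic: for each such $\rho$ there is $\eta>0$ such that, in all charts and at all points, $c^{ij}(\theta,\rho,\partial\rho)\,\xi_i\xi_j\ge\eta\,|\xi|^2$ for all tangent vectors $\xi=\xi_k\tau^k$. Moreover, given $0\le s_1<\rho_0$ and $R\ge0$, there is one $\eta>0$ such that $c^{ij}(\theta,s,v)\,\xi_i\xi_j\ge\eta\,|\xi|^2$ for all charts, all $\theta\in\Theta$, all $|s|\le s_1$, all $v$ with $|v_i\tau^i|\le R$ and all $\xi=\xi_k\tau^k$. -/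

import Mathlib

open scoped ENNReal NNReal Topology RealInnerProductSpace

noncomputable section

namespace Hypersurf

/-- The ambient space `ℝⁿ` with `n = m + 1`. -/
abbrev Amb (m : ℕ) := EuclideanSpace ℝ (Fin (m + 1))

/-- The parameter space `ℝⁿ⁻¹`. -/
abbrev Par (m : ℕ) := EuclideanSpace ℝ (Fin m)

/-- The type of local diffeomorphisms `Φ` between open sets of `ℝⁿ` and of `ℝⁿ⁻¹ × ℝ`. -/
abbrev Flattening (m : ℕ) := OpenPartialHomeomorph (Amb m) (Par m × ℝ)

/-- `Φ` is a `C^k`-diffeomorphism that flattens `S`: inside its domain, `S` is the preimage of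
`ℝⁿ⁻¹ × {0}`. -/
structure IsChart {m : ℕ} (k : WithTop ℕ∞) (S : Set (Amb m)) (Φ : Flattening m) : Prop where
  contDiffOn : ContDiffOn ℝ k Φ Φ.source
  contDiffOn_symm : ContDiffOn ℝ k Φ.symm Φ.target
  mem_iff : ∀ x ∈ Φ.source, x ∈ S ↔ (Φ x).2 = 0

/-- The local parametrization `φ(θ) = Φ⁻¹(θ, 0)` of a chart. -/
def param {m : ℕ} (Φ : Flattening m) (θ : Par m) : Amb m := Φ.symm (θ, 0)

/-- The open parameter set of a chart. -/
def paramSet {m : ℕ} (Φ : Flattening m) : Set (Par m) := {θ | (θ, (0 : ℝ)) ∈ Φ.target}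

/-- `S` is a closed embedded hypersurface of class `C^k` that encloses the bounded domain `Ω`:
`S` is the boundary of `Ω`, it can be flattened near each of its points, and `Ω` lies on one
side of it there. -/
structure IsClosedHypersurface {m : ℕ} (k : WithTop ℕ∞) (Ω S : Set (Amb m)) : Prop where
  isOpen : IsOpen Ω
  isConnected : IsConnected Ω
  isBounded : Bornology.IsBounded Ω
  frontier_eq : frontier Ω = S
  exists_chart : ∀ p ∈ S, ∃ Φ : Flattening m, IsChart k S Φ ∧ p ∈ Φ.source ∧
    ∀ x ∈ Φ.source, x ∈ Ω ↔ (Φ x).2 < 0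

/-! ### Local geometry of a parametrized hypersurface `φ` with unit normal `N` -/

/-- The partial derivative `∂ᵢ`. -/
def pd {m : ℕ} {F : Type*} [NormedAddCommGroup F] [NormedSpace ℝ F] (i : Fin m)
    (f : Par m → F) (θ : Par m) : F :=
  fderiv ℝ f θ (EuclideanSpace.single i 1)

/-- The tangent vectors `τᵢ = ∂ᵢφ`. -/
def tau {m : ℕ} (φ : Par m → Amb m) (i : Fin m) (θ : Par m) : Amb m := pd i φ θ

/-- The first fundamental form `gᵢⱼ = (τᵢ|τⱼ)`. -/
def firstForm {m : ℕ} (φ : Par m → Amb m) (θ : Par m) : Matrix (Fin m) (Fin m) ℝ :=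
  Matrix.of fun i j => ⟪tau φ i θ, tau φ j θ⟫

/-- The dual basis `τⁱ = gⁱᵏ τₖ`. -/
def tauDual {m : ℕ} (φ : Par m → Amb m) (i : Fin m) (θ : Par m) : Amb m :=
  ∑ k, (firstForm φ θ)⁻¹ i k • tau φ k θ

/-- The second fundamental form `lᵢⱼ = (∂ᵢ∂ⱼφ|N)`. -/
def secondForm {m : ℕ} (φ N : Par m → Amb m) (θ : Par m) : Matrix (Fin m) (Fin m) ℝ :=
  Matrix.of fun i j => ⟪pd i (pd j φ) θ, N θ⟫

/-- The shape matrix `K = G⁻¹L`. -/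
def shapeMatrix {m : ℕ} (φ N : Par m → Amb m) (θ : Par m) : Matrix (Fin m) (Fin m) ℝ :=
  (firstForm φ θ)⁻¹ * secondForm φ N θ

/-- The mean curvature, i.e. the trace of the shape matrix. -/
def meanCurvature {m : ℕ} (φ N : Par m → Amb m) (θ : Par m) : ℝ := (shapeMatrix φ N θ).trace

/-- The Weingarten tensor `lᵢⱼ τⁱ ⊗ τʲ`, where `(a ⊗ b) x = (b|x) a`. -/
def weingarten {m : ℕ} (φ N : Par m → Amb m) (θ : Par m) : Amb m →L[ℝ] Amb m :=
  ∑ i, ∑ j, secondForm φ N θ i j •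
    InnerProductSpace.rankOne ℝ (tauDual φ i θ) (tauDual φ j θ)

/-- The tangent vector `vᵢ τⁱ` with covariant components `vᵢ`. -/
def tangentVec {m : ℕ} (φ : Par m → Amb m) (θ : Par m) (v : Fin m → ℝ) : Amb m :=
  ∑ i, v i • tauDual φ i θ

/-- The covariant components `∂ᵢρ` of the surface gradient of a scalar field (in the chart). -/
def grad {m : ℕ} (r : Par m → ℝ) (θ : Par m) : Fin m → ℝ := fun i => pd i r θ

/-- The surface gradient `τʲ ⊗ ∂ⱼf` of a vector field (in the chart). -/
def surfaceGradVec {m : ℕ} (φ : Par m → Amb m) (f : Par m → Amb m) (θ : Par m) :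
    Amb m →L[ℝ] Amb m :=
  ∑ j, InnerProductSpace.rankOne ℝ (tauDual φ j θ) (pd j f θ)

/-- The trace of an operator on `ℝⁿ`. -/
def tr {m : ℕ} (T : Amb m →L[ℝ] Amb m) : ℝ := LinearMap.trace ℝ (Amb m) (T : Amb m →ₗ[ℝ] Amb m)

/-! ### `M₀`, `a`, `β` as functions of a point `θ`, a value `s` of `ρ` and covariant components
`v` of `∇ρ` -/

/-- `M₀ = (I - s L)⁻¹`. -/
def M₀ {m : ℕ} (φ N : Par m → Amb m) (θ : Par m) (s : ℝ) : Amb m →L[ℝ] Amb m :=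
  Ring.inverse (1 - s • weingarten φ N θ)

/-- `a = M₀ ∇ρ`. -/
def aVec {m : ℕ} (φ N : Par m → Amb m) (θ : Par m) (s : ℝ) (v : Fin m → ℝ) : Amb m :=
  M₀ φ N θ s (tangentVec φ θ v)

/-- `β = (1 + |a|²)^{-1/2}`. -/
def beta {m : ℕ} (φ N : Par m → Amb m) (θ : Par m) (s : ℝ) (v : Fin m → ℝ) : ℝ :=
  (1 + ‖aVec φ N θ s v‖ ^ 2) ^ (-(1 / 2) : ℝ)

/-- The leading coefficients `cⁱʲ = β [M₀²]ⁱʲ - β³ [M₀²∇ρ]ⁱ [M₀²∇ρ]ʲ`, where upper indices denote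
contravariant components. -/
def coeff {m : ℕ} (φ N : Par m → Amb m) (θ : Par m) (s : ℝ) (v : Fin m → ℝ) (i j : Fin m) : ℝ :=
  beta φ N θ s v * ⟪tauDual φ i θ, (M₀ φ N θ s ^ 2) (tauDual φ j θ)⟫
    - beta φ N θ s v ^ 3 * ⟪(M₀ φ N θ s ^ 2) (tangentVec φ θ v), tauDual φ i θ⟫
      * ⟪(M₀ φ N θ s ^ 2) (tangentVec φ θ v), tauDual φ j θ⟫

/-- The vector field `a(ρ)`, for the scalar field `r = ρ ∘ φ`. -/
def aField {m : ℕ} (φ N : Par m → Amb m) (r : Par m → ℝ) (θ : Par m) : Amb m :=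
  aVec φ N θ (r θ) (grad r θ)

/-- The right-hand side
`β { tr[M₀ (L + ∇a)] - β² (M₀ a | [∇a] a) }` of the curvature formula. -/
def curvatureFormula {m : ℕ} (φ N : Par m → Amb m) (r : Par m → ℝ) (θ : Par m) : ℝ :=
  beta φ N θ (r θ) (grad r θ) *
    (tr (M₀ φ N θ (r θ) * (weingarten φ N θ + surfaceGradVec φ (aField φ N r) θ))
      - beta φ N θ (r θ) (grad r θ) ^ 2 *
        ⟪M₀ φ N θ (r θ) (aField φ N r θ),
          surfaceGradVec φ (aField φ N r) θ (aField φ N r θ)⟫)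

/-- The parametrization `φ + r N` of the hypersurface `Γ_ρ`. -/
def gammaParam {m : ℕ} (φ N : Par m → Amb m) (r : Par m → ℝ) (θ : Par m) : Amb m :=
  φ θ + r θ • N θ

/-- `w` is the unit normal, at the parameter `θ`, of the hypersurface parametrized by `ψ` that
lies on the same side as `n`. -/
def IsUnitNormalAt {m : ℕ} (ψ : Par m → Amb m) (n : Amb m) (θ : Par m) (w : Amb m) : Prop :=
  ‖w‖ = 1 ∧ (∀ i, ⟪w, tau ψ i θ⟫ = 0) ∧ 0 < ⟪w, n⟫

/-! ### Global quantities on `S` -/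

/-- `ν` is the outer unit normal of `S` with respect to `Ω` (only its values on `S` matter). -/
def IsOuterNormal {m : ℕ} (k : WithTop ℕ∞) (Ω S : Set (Amb m)) (ν : Amb m → Amb m) : Prop :=
  ∀ p ∈ S, ‖ν p‖ = 1 ∧
    (∀ Φ : Flattening m, IsChart k S Φ → ∀ θ ∈ paramSet Φ, param Φ θ = p →
      ∀ i, ⟪ν p, tau (param Φ) i θ⟫ = 0) ∧
    ∀ᶠ t in 𝓝[>] (0 : ℝ), p - t • ν p ∈ Ω ∧ p + t • ν p ∉ closure Ω

/-- `ρ` is of class `C²` on `S`, i.e. in all charts (only its values on `S` matter). -/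
def IsC2On {m : ℕ} (k : WithTop ℕ∞) (S : Set (Amb m)) (ρ : Amb m → ℝ) : Prop :=
  ∀ Φ : Flattening m, IsChart k S Φ → ContDiffOn ℝ 2 (ρ ∘ param Φ) (paramSet Φ)

/-- The principal curvatures of `S` at all its points: the eigenvalues of the shape matrices. -/
def principalCurvatures {m : ℕ} (k : WithTop ℕ∞) (S : Set (Amb m)) (ν : Amb m → Amb m) : Set ℝ :=
  {κ | ∃ Φ : Flattening m, IsChart k S Φ ∧ ∃ θ ∈ paramSet Φ,
    Module.End.HasEigenvalue (Matrix.toLin' (shapeMatrix (param Φ) (ν ∘ param Φ) θ)) κ}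

/-- `ρ₀ = 1 / max |κᵢ|`. -/
def rhoBound {m : ℕ} (k : WithTop ℕ∞) (S : Set (Amb m)) (ν : Amb m → Amb m) : ℝ≥0∞ :=
  (⨆ κ ∈ principalCurvatures k S ν, ‖κ‖ₑ)⁻¹

/-- The supremum norm `|ρ|_∞` on `S`. -/
def supNorm {m : ℕ} (S : Set (Amb m)) (ρ : Amb m → ℝ) : ℝ≥0∞ := ⨆ p ∈ S, ‖ρ p‖ₑ

/-- The admissible height functions: `ρ ∈ C²(S)` with `|ρ|_∞ < ρ₀`. -/
def IsAdmissible {m : ℕ} (k : WithTop ℕ∞) (S : Set (Amb m)) (ν : Amb m → Amb m)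
    (ρ : Amb m → ℝ) : Prop :=
  IsC2On k S ρ ∧ supNorm S ρ < rhoBound k S ν

end Hypersurf

end

open Hypersurf

/-! Write `L` for the Weingarten tensor and `ψ = φ + ρN`. The Weingarten equation `∂ᵢN = -Lτᵢ` gives
`ψ` the tangent vectors `(I - ρL)τᵢ + ∂ᵢρ N`. Since `L` is symmetric and kills `N`, the operator
`M₀` is self-adjoint, fixes `N`, and maps these vectors to `τᵢ + ∂ᵢρ N`. All pointwise facts follow
from this (`HasGraphTangents.inner_M₀`): the vectors `M₀τʲ` are biorthogonal to the `∂ᵢψ`, which are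
therefore independent; `N - a` is orthogonal to them, so the normal is `β(N - a)`; and the dual
basis of the graph is `M₀τʲ` minus its normal component. Hence `cⁱʲ` is `β` times the inverse metric
of the graph (`HasGraphTangents.coeff_eq`), and `κ = cⁱʲ (∂ᵢ∂ⱼψ | N - a)`.

Both formulas for `κ` evaluate this sum. Expanding `∂ᵢ∂ⱼψ`, second derivatives of `ρ` occur only
along `N`, and `(N | N - a) = 1`: this is the quasilinear form. Differentiating `(∂ⱼψ | N - a) = 0`
instead replaces `(∂ᵢ∂ⱼψ | N - a)` by `(∂ⱼψ | Lτᵢ + ∂ᵢa)`, and contraction produces the trace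
formula.

For ellipticity, `cⁱʲξᵢξⱼ = β|M₀ξ|² - β³(a | M₀ξ)²`, which by Cauchy–Schwarz and `β²(1 + |a|²) = 1`
is at least `β³|M₀ξ|²`. The norm of `L` is bounded by the principal curvatures, so `‖sL‖ ≤ q < 1` in
all charts at once; this bounds `|M₀ξ|` below and `|a|` above. Compactness of the surface bounds
`|∇ρ|` independently of the chart.

The normal is given only by orthogonality and by its side; it is `C²` because it is the normalized
gradient of the last component of a one-sided chart. -/

namespace Hypersurf

/-- The tangent vectors of `φ` at `θ` are linearly independent and `n` is a unit normal. -/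
structure IsFrame {m : ℕ} (φ : Par m → Amb m) (θ : Par m) (n : Amb m) : Prop where
  linearIndependent : LinearIndependent ℝ fun i => tau φ i θ
  norm_eq_one : ‖n‖ = 1
  inner_tau : ∀ i, ⟪n, tau φ i θ⟫ = 0

/-! ### Frames, dual bases and the Weingarten tensor at one point. -/

section Frame

variable {m : ℕ} {φ N : Par m → Amb m} {θ : Par m} {n : Amb m}

lemma firstForm_mul_inv (h : LinearIndependent ℝ fun i => tau φ i θ) :
    firstForm φ θ * (firstForm φ θ)⁻¹ = 1 := by
  have hpos : (firstForm φ θ).PosDef := Matrix.posDef_gram_of_linearIndependent h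
  exact Matrix.mul_nonsing_inv _ hpos.det_pos.ne'.isUnit

lemma firstForm_symm (φ : Par m → Amb m) (θ : Par m) (i j : Fin m) :
    firstForm φ θ i j = firstForm φ θ j i :=
  real_inner_comm (tau φ j θ) (tau φ i θ)

lemma firstForm_inv_symm (φ : Par m → Amb m) (θ : Par m) (i j : Fin m) :
    (firstForm φ θ)⁻¹ i j = (firstForm φ θ)⁻¹ j i := by
  have hT : (firstForm φ θ).transpose = firstForm φ θ := by
    ext i j
    exact firstForm_symm φ θ j i
  have := congrFun (congrFun (Matrix.transpose_nonsing_inv (firstForm φ θ)) j) i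
  rwa [hT] at this

lemma inner_tau_tauDual (h : LinearIndependent ℝ fun i => tau φ i θ) (i j : Fin m) :
    ⟪tau φ i θ, tauDual φ j θ⟫ = if i = j then 1 else 0 := by
  have := congrFun (congrFun (firstForm_mul_inv h) i) j
  rw [Matrix.mul_apply, Matrix.one_apply] at this
  rw [← this, tauDual, inner_sum]
  refine Finset.sum_congr rfl fun k _ => ?_
  rw [real_inner_smul_right, firstForm_inv_symm φ θ j k, mul_comm]
  rfl

lemma inner_tauDual_tau (h : LinearIndependent ℝ fun i => tau φ i θ) (i j : Fin m) :
    ⟪tauDual φ i θ, tau φ j θ⟫ = if j = i then 1 else 0 := by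
  rw [real_inner_comm, inner_tau_tauDual h]

lemma inner_tangentVec_tau (h : LinearIndependent ℝ fun i => tau φ i θ) (v : Fin m → ℝ)
    (i : Fin m) : ⟪tangentVec φ θ v, tau φ i θ⟫ = v i := by
  rw [tangentVec, sum_inner]
  simp [real_inner_smul_left, inner_tauDual_tau h]

namespace IsFrame

/-- A unit vector orthogonal to the `τᵢ` is not in their span, so `n` and the `τᵢ` are `m + 1`
independent vectors of `ℝᵐ⁺¹` and span it. -/
lemma eq_zero_of_orthogonal (h : IsFrame φ θ n) {x : Amb m}
    (hx : ∀ i, ⟪x, tau φ i θ⟫ = 0) (hn : ⟪x, n⟫ = 0) : x = 0 := by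
  have hspan : ∀ y ∈ Submodule.span ℝ (Set.range fun i => tau φ i θ), ⟪n, y⟫ = 0 := by
    intro y hy
    induction hy using Submodule.span_induction with
    | mem y hy => obtain ⟨i, rfl⟩ := hy; exact h.inner_tau i
    | zero => simp
    | add a b _ _ ha hb => rw [inner_add_right, ha, hb, add_zero]
    | smul c a _ ha => rw [real_inner_smul_right, ha, mul_zero]
  have hli : LinearIndependent ℝ (Fin.cons n (fun i => tau φ i θ) : Fin (m + 1) → Amb m) := by
    rw [linearIndependent_finCons]
    refine ⟨h.linearIndependent, fun hmem => ?_⟩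
    have := hspan n hmem
    rw [real_inner_self_eq_norm_sq, h.norm_eq_one] at this
    norm_num at this
  have htop := hli.span_eq_top_of_card_eq_finrank' (by simp)
  have hmem : x ∈ Submodule.span ℝ
      (Set.range (Fin.cons n (fun i => tau φ i θ) : Fin (m + 1) → Amb m)) := htop ▸ trivial
  have key : ∀ y ∈ Submodule.span ℝ
      (Set.range (Fin.cons n (fun i => tau φ i θ) : Fin (m + 1) → Amb m)), ⟪x, y⟫ = 0 := by
    intro y hy
    induction hy using Submodule.span_induction with
    | mem y hy =>
      obtain ⟨i, rfl⟩ := hy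
      refine Fin.cases ?_ (fun i => ?_) i
      · simpa using hn
      · simpa using hx i
    | zero => simp
    | add a b _ _ ha hb => rw [inner_add_right, ha, hb, add_zero]
    | smul c a _ ha => rw [real_inner_smul_right, ha, mul_zero]
  exact inner_self_eq_zero.mp (key x hmem)

lemma inner_self (h : IsFrame φ θ n) : ⟪n, n⟫ = 1 := by
  rw [real_inner_self_eq_norm_sq, h.norm_eq_one, one_pow]

lemma inner_tauDual (h : IsFrame φ θ n) (i : Fin m) : ⟪n, tauDual φ i θ⟫ = 0 := by
  rw [tauDual, inner_sum]
  simp [real_inner_smul_right, h.inner_tau]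

lemma tauDual_inner (h : IsFrame φ θ n) (i : Fin m) : ⟪tauDual φ i θ, n⟫ = 0 := by
  rw [real_inner_comm, h.inner_tauDual]

lemma inner_tangentVec (h : IsFrame φ θ n) (v : Fin m → ℝ) : ⟪n, tangentVec φ θ v⟫ = 0 := by
  rw [tangentVec, inner_sum]
  simp [real_inner_smul_right, h.inner_tauDual]

lemma sum_inner_tau_smul_tauDual (h : IsFrame φ θ n) (x : Amb m) :
    (∑ i, ⟪x, tau φ i θ⟫ • tauDual φ i θ) + ⟪x, n⟫ • n = x := by
  rw [← sub_eq_zero]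
  refine h.eq_zero_of_orthogonal (fun k => ?_) ?_
  · rw [inner_sub_left, inner_add_left, sum_inner, real_inner_smul_left, h.inner_tau]
    simp [real_inner_smul_left, inner_tauDual_tau h.linearIndependent]
  · rw [inner_sub_left, inner_add_left, sum_inner, real_inner_smul_left, h.inner_self]
    simp [real_inner_smul_left, h.tauDual_inner]

/-- The scalar product expressed through the tangent vectors, their dual basis and the normal. -/
lemma sum_inner_tau_mul_inner_tauDual (h : IsFrame φ θ n) (x y : Amb m) :
    ⟪x, y⟫ = (∑ i, ⟪x, tau φ i θ⟫ * ⟪tauDual φ i θ, y⟫) + ⟪x, n⟫ * ⟪n, y⟫ := by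
  conv_lhs => rw [← h.sum_inner_tau_smul_tauDual x]
  rw [inner_add_left, sum_inner, real_inner_smul_left]
  simp only [real_inner_smul_left]

/-- Orthogonality leaves only a multiple of `n`, the unit norm makes the factor `±1`, and the common
side `n'` decides the sign. -/
lemma eq_of_isUnitNormalAt (h : IsFrame φ θ n) {n' w : Amb m} (hn : 0 < ⟪n, n'⟫)
    (hw : IsUnitNormalAt φ n' θ w) : w = n := by
  obtain ⟨hw1, hw2, hw3⟩ := hw
  have hdec := h.sum_inner_tau_smul_tauDual w
  simp only [hw2, zero_smul, Finset.sum_const_zero, zero_add] at hdec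
  have habs : |⟪w, n⟫| = 1 := by
    have := congrArg norm hdec
    rwa [norm_smul, h.norm_eq_one, hw1, mul_one, Real.norm_eq_abs] at this
  have hpos : 0 < ⟪w, n⟫ := by
    rw [← hdec, real_inner_smul_left] at hw3
    exact (pos_iff_pos_of_mul_pos hw3).mpr hn
  rw [abs_of_pos hpos] at habs
  rw [← hdec, habs, one_smul]

end IsFrame

/-! ### The Weingarten tensor -/

lemma weingarten_apply (φ N : Par m → Amb m) (θ : Par m) (x : Amb m) :
    weingarten φ N θ x =
      ∑ i, ∑ j, (secondForm φ N θ i j * ⟪tauDual φ j θ, x⟫) • tauDual φ i θ := by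
  simp [weingarten, smul_smul]

lemma inner_weingarten (φ N : Par m → Amb m) (θ : Par m) (x y : Amb m) :
    ⟪y, weingarten φ N θ x⟫ =
      ∑ i, ∑ j, secondForm φ N θ i j * ⟪y, tauDual φ i θ⟫ * ⟪x, tauDual φ j θ⟫ := by
  simp only [weingarten_apply, inner_sum, real_inner_smul_right]
  refine Finset.sum_congr rfl fun i _ => Finset.sum_congr rfl fun j _ => ?_
  rw [real_inner_comm x]
  ring

lemma inner_weingarten_comm (hL : ∀ i j, secondForm φ N θ i j = secondForm φ N θ j i)
    (x y : Amb m) : ⟪weingarten φ N θ x, y⟫ = ⟪x, weingarten φ N θ y⟫ := by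
  rw [real_inner_comm, inner_weingarten, inner_weingarten, Finset.sum_comm]
  refine Finset.sum_congr rfl fun i _ => Finset.sum_congr rfl fun j _ => ?_
  rw [hL j i]
  ring

lemma inner_tau_weingarten_tau (h : LinearIndependent ℝ fun i => tau φ i θ) (i j : Fin m) :
    ⟪tau φ i θ, weingarten φ N θ (tau φ j θ)⟫ = secondForm φ N θ i j := by
  simp [inner_weingarten, inner_tau_tauDual h]

lemma IsFrame.weingarten_normal (h : IsFrame φ θ n) : weingarten φ N θ n = 0 := by
  simp [weingarten_apply, h.tauDual_inner]

lemma IsFrame.inner_normal_weingarten (h : IsFrame φ θ n) (x : Amb m) :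
    ⟪n, weingarten φ N θ x⟫ = 0 := by
  simp [inner_weingarten, h.inner_tauDual]

/-- A nonzero eigenvalue of the Weingarten tensor is an eigenvalue of the shape matrix. -/
lemma IsFrame.hasEigenvalue_shapeMatrix (h : IsFrame φ θ n) {c : ℝ} (hc : c ≠ 0) {x : Amb m}
    (hx0 : x ≠ 0) (hx : weingarten φ N θ x = c • x) :
    Module.End.HasEigenvalue (Matrix.toLin' (shapeMatrix φ N θ)) c := by
  have hn : ⟪x, n⟫ = 0 := by
    have h1 := h.inner_normal_weingarten (N := N) x
    rw [hx, real_inner_smul_right] at h1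
    rw [real_inner_comm]
    exact (mul_eq_zero.mp h1).resolve_left hc
  -- The candidate eigenvector consists of the contravariant components of `x`; they cannot all
  -- vanish because `x` is tangential.
  have hξ : (fun i => ⟪x, tauDual φ i θ⟫) ≠ 0 := by
    intro h0
    have h1 := h.sum_inner_tau_mul_inner_tauDual x x
    rw [hn, zero_mul, add_zero] at h1
    refine hx0 ((inner_self_eq_zero (𝕜 := ℝ)).mp (h1.trans (Finset.sum_eq_zero fun i _ => ?_)))
    rw [real_inner_comm x, congrFun h0 i]
    simp
  refine Module.End.hasEigenvalue_of_hasEigenvector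
    (x := fun i => ⟪x, tauDual φ i θ⟫) ⟨?_, hξ⟩
  rw [Module.End.mem_eigenspace_iff, Matrix.toLin'_apply]
  have hl : ∀ k, (secondForm φ N θ).mulVec (fun i => ⟪x, tauDual φ i θ⟫) k
      = c * ⟪tau φ k θ, x⟫ := by
    intro k
    rw [← real_inner_smul_right, ← hx, inner_weingarten]
    simp [inner_tau_tauDual h.linearIndependent, Matrix.mulVec, dotProduct]
  ext i
  rw [shapeMatrix, ← Matrix.mulVec_mulVec, Matrix.mulVec, dotProduct]
  simp only [hl, Pi.smul_apply, smul_eq_mul]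
  rw [real_inner_comm, tauDual, sum_inner, Finset.mul_sum]
  refine Finset.sum_congr rfl fun k _ => ?_
  rw [real_inner_smul_left]
  ring

end Frame

/-- The norm of a symmetric operator is bounded by its nonzero eigenvalues. -/
lemma norm_le_of_forall_eigenvalue {m : ℕ} {T : Amb m →L[ℝ] Amb m}
    (hT : ∀ x y, ⟪T x, y⟫ = ⟪x, T y⟫) {C : ℝ} (hC : 0 ≤ C)
    (h : ∀ c : ℝ, c ≠ 0 → ∀ x : Amb m, x ≠ 0 → T x = c • x → |c| ≤ C) : ‖T‖ ≤ C := by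
  have hs : (T : Amb m →ₗ[ℝ] Amb m).IsSymmetric := hT
  have hfin : Module.finrank ℝ (Amb m) = m + 1 := by simp
  set b := hs.eigenvectorBasis hfin
  have hev : ∀ i, |hs.eigenvalues hfin i| ≤ C := by
    intro i
    -- The kernel needs no bound. For the Weingarten tensor it contains the normal, which belongs to
    -- no principal curvature.
    by_cases h0 : hs.eigenvalues hfin i = 0
    · rw [h0, abs_zero]
      exact hC
    · refine h _ h0 (b i) (b.orthonormal.ne_zero i) ?_
      exact hs.apply_eigenvectorBasis hfin i
  refine ContinuousLinearMap.opNorm_le_bound _ hC fun x => ?_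
  refine le_of_sq_le_sq ?_ (by positivity)
  rw [mul_pow, ← b.sum_sq_norm_inner_right (T x), ← b.sum_sq_norm_inner_right x, Finset.mul_sum]
  refine Finset.sum_le_sum fun i _ => ?_
  have : ⟪b i, T x⟫ = hs.eigenvalues hfin i * ⟪b i, x⟫ := by
    rw [← hT, show T (b i) = _ from hs.apply_eigenvectorBasis hfin i]
    simp [real_inner_smul_left, b]
  rw [this, norm_mul, mul_pow]
  gcongr
  exact hev i

end Hypersurf

/-! ### Pointwise algebra of normal graphs. -/

namespace Hypersurf

variable {m : ℕ} {φ N ψ : Par m → Amb m} {θ : Par m} {n : Amb m} {s : ℝ} {v : Fin m → ℝ}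

/-! ### The operator `M₀` -/

lemma sub_weingarten_M₀ (hA : IsUnit (1 - s • weingarten φ N θ)) (x : Amb m) :
    M₀ φ N θ s x - s • weingarten φ N θ (M₀ φ N θ s x) = x := by
  have := congrArg (fun T : Amb m →L[ℝ] Amb m => T x) (Ring.mul_inverse_cancel _ hA)
  simpa [M₀] using this

lemma M₀_sub_weingarten (hA : IsUnit (1 - s • weingarten φ N θ)) (x : Amb m) :
    M₀ φ N θ s (x - s • weingarten φ N θ x) = x := by
  have := congrArg (fun T : Amb m →L[ℝ] Amb m => T x) (Ring.inverse_mul_cancel _ hA)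
  simpa [M₀] using this

/-- The inverse of a symmetric operator is symmetric: substitute `y = (I - sL)M₀y` on one side and
`x = (I - sL)M₀x` on the other. -/
lemma inner_M₀_comm (hL : ∀ i j, secondForm φ N θ i j = secondForm φ N θ j i)
    (hA : IsUnit (1 - s • weingarten φ N θ)) (x y : Amb m) :
    ⟪M₀ φ N θ s x, y⟫ = ⟪x, M₀ φ N θ s y⟫ := by
  conv_lhs => rw [← sub_weingarten_M₀ hA y]
  conv_rhs => rw [← sub_weingarten_M₀ hA x]
  simp only [inner_sub_left, inner_sub_right, real_inner_smul_left, real_inner_smul_right,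
    inner_weingarten_comm hL]

lemma M₀_sq_apply (x : Amb m) : (M₀ φ N θ s ^ 2) x = M₀ φ N θ s (M₀ φ N θ s x) := by
  rw [pow_two]
  rfl

lemma IsFrame.M₀_normal (h : IsFrame φ θ n) (hA : IsUnit (1 - s • weingarten φ N θ)) :
    M₀ φ N θ s n = n := by
  have := M₀_sub_weingarten hA n
  rwa [h.weingarten_normal, smul_zero, sub_zero] at this

lemma IsFrame.inner_normal_M₀ (h : IsFrame φ θ n) (hA : IsUnit (1 - s • weingarten φ N θ))
    (x : Amb m) : ⟪n, M₀ φ N θ s x⟫ = ⟪n, x⟫ := by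
  conv_rhs => rw [← sub_weingarten_M₀ hA x]
  rw [inner_sub_right, real_inner_smul_right, h.inner_normal_weingarten, mul_zero, sub_zero]

lemma IsFrame.inner_normal_aVec (h : IsFrame φ θ n) (hA : IsUnit (1 - s • weingarten φ N θ))
    (v : Fin m → ℝ) : ⟪n, aVec φ N θ s v⟫ = 0 := by
  rw [aVec, h.inner_normal_M₀ hA, h.inner_tangentVec]

/-! ### The factor `β` -/

lemma beta_pos (φ N : Par m → Amb m) (θ : Par m) (s : ℝ) (v : Fin m → ℝ) :
    0 < beta φ N θ s v := by
  unfold beta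
  positivity

lemma beta_sq (φ N : Par m → Amb m) (θ : Par m) (s : ℝ) (v : Fin m → ℝ) :
    beta φ N θ s v ^ 2 * (1 + ‖aVec φ N θ s v‖ ^ 2) = 1 := by
  have h0 : (0 : ℝ) < 1 + ‖aVec φ N θ s v‖ ^ 2 := by positivity
  rw [beta, ← Real.rpow_mul_natCast h0.le]
  norm_num
  rw [Real.rpow_neg_one, inv_mul_cancel₀ h0.ne']

/-! ### The normal graph -/

/-- The dual basis of a frame, computed from any family biorthogonal to the tangent vectors. -/
lemma IsFrame.tauDual_eq (h : IsFrame φ θ n) {x : Amb m} {j : Fin m}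
    (hx : ∀ i, ⟪x, tau φ i θ⟫ = if i = j then 1 else 0) :
    tauDual φ j θ = x - ⟪x, n⟫ • n := by
  rw [eq_sub_iff_add_eq]
  conv_rhs => rw [← h.sum_inner_tau_smul_tauDual x]
  simp [hx]

lemma firstForm_inv_apply (h : LinearIndependent ℝ fun i => tau φ i θ) (i j : Fin m) :
    (firstForm φ θ)⁻¹ i j = ⟪tauDual φ i θ, tauDual φ j θ⟫ := by
  conv_rhs => rw [tauDual, sum_inner]
  simp [real_inner_smul_left, inner_tau_tauDual h]

/-- `ψ` has at `θ` the tangent vectors `(I - sL)τᵢ + vᵢ N` of a normal graph over `φ`. -/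
def HasGraphTangents (φ N ψ : Par m → Amb m) (θ : Par m) (s : ℝ) (v : Fin m → ℝ) : Prop :=
  ∀ i, tau ψ i θ = tau φ i θ - s • weingarten φ N θ (tau φ i θ) + v i • N θ

section Graph

variable (h : IsFrame φ θ (N θ)) (hL : ∀ i j, secondForm φ N θ i j = secondForm φ N θ j i)
  (hA : IsUnit (1 - s • weingarten φ N θ)) (hψ : HasGraphTangents φ N ψ θ s v)

include h hL hA hψ

/-- Moving `M₀` to the other factor undoes `I - sL` and fixes `N`, so the graph tangent becomes `τᵢ
+ vᵢN`. -/
lemma HasGraphTangents.inner_M₀ (x : Amb m) (i : Fin m) :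
    ⟪M₀ φ N θ s x, tau ψ i θ⟫ = ⟪x, tau φ i θ⟫ + v i * ⟪N θ, x⟫ := by
  rw [inner_M₀_comm hL hA, hψ i, map_add, M₀_sub_weingarten hA, map_smul, h.M₀_normal hA,
    inner_add_right, real_inner_smul_right, real_inner_comm x]

lemma HasGraphTangents.inner_M₀_tauDual (i j : Fin m) :
    ⟪M₀ φ N θ s (tauDual φ j θ), tau ψ i θ⟫ = if i = j then 1 else 0 := by
  rw [hψ.inner_M₀ h hL hA, h.inner_tauDual, inner_tauDual_tau h.linearIndependent, mul_zero,
    add_zero]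

/-- Biorthogonality to `M₀τʲ` gives independence. Both `N` and `a` have product `vᵢ` with the `i`-th
graph tangent, so `N - a` is normal; `a ⟂ N` makes its length `1/β`. -/
lemma HasGraphTangents.isFrame :
    IsFrame ψ θ (beta φ N θ s v • (N θ - aVec φ N θ s v)) where
  linearIndependent := by
    rw [Fintype.linearIndependent_iff]
    intro c hc j
    have h1 := congrArg (fun y => ⟪M₀ φ N θ s (tauDual φ j θ), y⟫) hc
    simpa [inner_sum, real_inner_smul_right, hψ.inner_M₀_tauDual h hL hA] using h1
  norm_eq_one := by
    have h1 : ‖N θ - aVec φ N θ s v‖ ^ 2 = 1 + ‖aVec φ N θ s v‖ ^ 2 := by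
      rw [norm_sub_sq_real, h.inner_normal_aVec hA, h.norm_eq_one]
      ring
    rw [← sq_eq_sq₀ (norm_nonneg _) zero_le_one, norm_smul, mul_pow, h1, Real.norm_eq_abs, sq_abs,
      beta_sq, one_pow]
  inner_tau i := by
    rw [real_inner_smul_left, inner_sub_left, aVec, hψ.inner_M₀ h hL hA,
      inner_tangentVec_tau h.linearIndependent, h.inner_tangentVec, hψ i, inner_add_right,
      inner_sub_right, real_inner_smul_right, real_inner_smul_right, h.inner_self, h.inner_tau,
      h.inner_normal_weingarten]
    ring

lemma HasGraphTangents.isUnitNormalAt :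
    IsUnitNormalAt ψ (N θ) θ (beta φ N θ s v • (N θ - aVec φ N θ s v)) := by
  have hf := hψ.isFrame h hL hA
  refine ⟨hf.norm_eq_one, hf.inner_tau, ?_⟩
  rw [real_inner_smul_left, inner_sub_left, h.inner_self, real_inner_comm,
    h.inner_normal_aVec hA, sub_zero, mul_one]
  exact beta_pos ..

lemma HasGraphTangents.eq_of_isUnitNormalAt {w : Amb m} (hw : IsUnitNormalAt ψ (N θ) θ w) :
    w = beta φ N θ s v • (N θ - aVec φ N θ s v) :=
  (hψ.isFrame h hL hA).eq_of_isUnitNormalAt (hψ.isUnitNormalAt h hL hA).2.2 hw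

/-- The vector `M₀τʲ` is already biorthogonal to the graph tangents; only its component along `β(N -
a)` must be removed, and `(M₀τʲ | N) = 0` turns the sign into a plus. -/
lemma HasGraphTangents.tauDual_eq (j : Fin m) :
    tauDual ψ j θ = M₀ φ N θ s (tauDual φ j θ) +
      (beta φ N θ s v ^ 2 * ⟪M₀ φ N θ s (tauDual φ j θ), aVec φ N θ s v⟫) •
        (N θ - aVec φ N θ s v) := by
  rw [(hψ.isFrame h hL hA).tauDual_eq fun i => hψ.inner_M₀_tauDual h hL hA i j,
    real_inner_smul_right, inner_sub_right, real_inner_comm (N θ), h.inner_normal_M₀ hA,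
    h.inner_tauDual, smul_smul, sub_eq_add_neg, ← neg_smul]
  congr 2
  ring

/-- The inverse metric is the Gram matrix of the dual basis, which the preceding formula makes
explicit. -/
lemma HasGraphTangents.coeff_eq (i j : Fin m) :
    coeff φ N θ s v i j = beta φ N θ s v * (firstForm ψ θ)⁻¹ i j := by
  have hf := hψ.isFrame h hL hA
  have hdual : ∀ k, ⟪tauDual ψ k θ, N θ - aVec φ N θ s v⟫ = 0 := by
    intro k
    have := hf.tauDual_inner k
    rw [real_inner_smul_right] at this
    exact (mul_eq_zero.mp this).resolve_left (beta_pos ..).ne'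
  rw [firstForm_inv_apply hf.linearIndependent]
  conv_rhs => rw [hψ.tauDual_eq h hL hA j, inner_add_right, real_inner_smul_right, hdual,
    hψ.tauDual_eq h hL hA i, inner_add_left, real_inner_smul_left, inner_sub_left,
    h.inner_normal_M₀ hA, h.inner_tauDual]
  rw [coeff, M₀_sq_apply, M₀_sq_apply, inner_M₀_comm hL hA (tauDual φ i θ) (M₀ _ _ _ _ _),
    inner_M₀_comm hL hA (M₀ _ _ _ _ _), inner_M₀_comm hL hA (M₀ _ _ _ _ _),
    inner_M₀_comm hL hA (tauDual φ i θ) (aVec _ _ _ _ _), ← inner_M₀_comm hL hA (aVec _ _ _ _ _),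
    ← inner_M₀_comm hL hA _ (tauDual φ i θ), ← inner_M₀_comm hL hA _ (tauDual φ j θ), ← aVec,
    real_inner_comm (tauDual φ i θ)]
  ring

lemma HasGraphTangents.sum_coeff_smul_tau (i : Fin m) :
    ∑ j, coeff φ N θ s v i j • tau ψ j θ = beta φ N θ s v • tauDual ψ i θ := by
  rw [tauDual, Finset.smul_sum]
  refine Finset.sum_congr rfl fun j _ => ?_
  rw [hψ.coeff_eq h hL hA, smul_smul]

lemma HasGraphTangents.meanCurvature_eq {NΓ : Par m → Amb m}
    (hN : IsUnitNormalAt ψ (N θ) θ (NΓ θ)) :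
    meanCurvature ψ NΓ θ =
      ∑ i, ∑ j, coeff φ N θ s v i j * ⟪pd i (pd j ψ) θ, N θ - aVec φ N θ s v⟫ := by
  rw [meanCurvature, shapeMatrix, Matrix.trace, Finset.sum_comm]
  refine Finset.sum_congr rfl fun i _ => ?_
  rw [Matrix.diag_apply, Matrix.mul_apply]
  refine Finset.sum_congr rfl fun j _ => ?_
  rw [hψ.coeff_eq h hL hA, firstForm_inv_symm ψ θ j i, secondForm, Matrix.of_apply,
    hψ.eq_of_isUnitNormalAt h hL hA hN, real_inner_smul_right]
  ring

/-- The curvature formula, from the derivatives `bᵢ` of the field `a`. -/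
lemma HasGraphTangents.sum_coeff_mul_inner {b : Fin m → Amb m}
    (hb : ∀ i, ⟪N θ, b i⟫ = ⟪weingarten φ N θ (tau φ i θ), aVec φ N θ s v⟫) :
    ∑ i, ∑ j, coeff φ N θ s v i j * ⟪tau ψ j θ, weingarten φ N θ (tau φ i θ) + b i⟫ =
      beta φ N θ s v *
        (tr (M₀ φ N θ s * (weingarten φ N θ +
            ∑ j, InnerProductSpace.rankOne ℝ (tauDual φ j θ) (b j)))
          - beta φ N θ s v ^ 2 * ⟪M₀ φ N θ s (aVec φ N θ s v),
            (∑ j, InnerProductSpace.rankOne ℝ (tauDual φ j θ) (b j)) (aVec φ N θ s v)⟫) := by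
  -- In this shape `L` merges with the tensor built from the `bⱼ`, and the trace becomes a sum of
  -- products with `M₀τʲ`.
  have hW : weingarten φ N θ = ∑ j, InnerProductSpace.rankOne ℝ (tauDual φ j θ)
      (weingarten φ N θ (tau φ j θ)) := by
    ext1 x
    conv_lhs => rw [← h.sum_inner_tau_smul_tauDual (weingarten φ N θ x),
      real_inner_comm, h.inner_normal_weingarten, zero_smul, add_zero]
    rw [sum_apply]
    refine Finset.sum_congr rfl fun j _ => ?_
    rw [InnerProductSpace.rankOne_apply, inner_weingarten_comm hL, inner_weingarten_comm hL,
      ← inner_weingarten_comm hL, real_inner_comm]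
  have htr : tr (M₀ φ N θ s * (weingarten φ N θ +
      ∑ j, InnerProductSpace.rankOne ℝ (tauDual φ j θ) (b j))) =
      ∑ j, ⟪M₀ φ N θ s (tauDual φ j θ), weingarten φ N θ (tau φ j θ) + b j⟫ := by
    conv_lhs => rw [hW, ← Finset.sum_add_distrib, Finset.mul_sum, tr]
    simp only [← map_add]
    rw [ContinuousLinearMap.toLinearMap_sum, map_sum]
    refine Finset.sum_congr rfl fun j _ => ?_
    rw [ContinuousLinearMap.mul_def, InnerProductSpace.comp_rankOne,
      InnerProductSpace.trace_rankOne, real_inner_comm]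
  rw [htr, sum_apply, inner_sum, Finset.mul_sum, ← Finset.sum_sub_distrib, Finset.mul_sum]
  refine Finset.sum_congr rfl fun i _ => ?_
  have hsum : ∑ j, coeff φ N θ s v i j * ⟪tau ψ j θ, weingarten φ N θ (tau φ i θ) + b i⟫ =
      ⟪∑ j, coeff φ N θ s v i j • tau ψ j θ, weingarten φ N θ (tau φ i θ) + b i⟫ := by
    simp only [sum_inner, real_inner_smul_left]
  -- The summand `M₀τⁱ` of the dual vector gives the trace. In the summand along `N - a`, `hb`
  -- cancels `(N | bᵢ)` against `(a | Lτᵢ)` and leaves `-(a | bᵢ)`.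
  rw [hsum, hψ.sum_coeff_smul_tau h hL hA, real_inner_smul_left, hψ.tauDual_eq h hL hA,
    inner_add_left, real_inner_smul_left, inner_sub_left, inner_add_right (N θ),
    inner_add_right (aVec _ _ _ _ _), h.inner_normal_weingarten, hb i,
    InnerProductSpace.rankOne_apply, real_inner_smul_right, inner_M₀_comm hL hA (aVec _ _ _ _ _),
    real_inner_comm (aVec φ N θ s v) (M₀ φ N θ s _),
    real_inner_comm (aVec φ N θ s v) (weingarten φ N θ _), real_inner_comm (aVec φ N θ s v) (b i)]
  ring

end Graph

/-! ### Ellipticity -/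

lemma sum_coeff_mul_mul (φ N : Par m → Amb m) (θ : Par m) (s : ℝ) (v ξ : Fin m → ℝ) :
    ∑ i, ∑ j, coeff φ N θ s v i j * ξ i * ξ j =
      beta φ N θ s v * ⟪tangentVec φ θ ξ, (M₀ φ N θ s ^ 2) (tangentVec φ θ ξ)⟫
        - beta φ N θ s v ^ 3 * ⟪(M₀ φ N θ s ^ 2) (tangentVec φ θ v), tangentVec φ θ ξ⟫ ^ 2 := by
  have h1 : ⟪tangentVec φ θ ξ, (M₀ φ N θ s ^ 2) (tangentVec φ θ ξ)⟫ =
      ∑ i, ∑ j, ξ i * (ξ j * ⟪tauDual φ i θ, (M₀ φ N θ s ^ 2) (tauDual φ j θ)⟫) := by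
    simp only [tangentVec, map_sum, map_smul, sum_inner, inner_sum, real_inner_smul_left,
      real_inner_smul_right]
    rw [Finset.sum_comm]
    refine Finset.sum_congr rfl fun i _ => Finset.sum_congr rfl fun j _ => ?_
    ring
  have h2 : ∀ w : Amb m, ⟪w, tangentVec φ θ ξ⟫ = ∑ i, ξ i * ⟪w, tauDual φ i θ⟫ := by
    intro w
    simp only [tangentVec, inner_sum, real_inner_smul_right]
  rw [h1, h2, pow_two (∑ i, _), Finset.sum_mul_sum, Finset.mul_sum, Finset.mul_sum,
    ← Finset.sum_sub_distrib]
  refine Finset.sum_congr rfl fun i _ => ?_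
  rw [Finset.mul_sum, Finset.mul_sum, ← Finset.sum_sub_distrib]
  refine Finset.sum_congr rfl fun j _ => ?_
  rw [coeff]
  ring

/-- Cauchy–Schwarz for `(a | M₀ξ)`, after writing `β = β³(1 + |a|²)`; the terms with `|a|²` cancel.
-/
lemma beta_pow_mul_norm_sq_le_sum_coeff
    (hL : ∀ i j, secondForm φ N θ i j = secondForm φ N θ j i)
    (hA : IsUnit (1 - s • weingarten φ N θ)) (ξ : Fin m → ℝ) :
    beta φ N θ s v ^ 3 * ‖M₀ φ N θ s (tangentVec φ θ ξ)‖ ^ 2 ≤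
      ∑ i, ∑ j, coeff φ N θ s v i j * ξ i * ξ j := by
  rw [sum_coeff_mul_mul, M₀_sq_apply, M₀_sq_apply, ← inner_M₀_comm hL hA,
    inner_M₀_comm hL hA (M₀ _ _ _ _ _), real_inner_self_eq_norm_sq,
    show M₀ φ N θ s (tangentVec φ θ v) = aVec φ N θ s v from rfl]
  set x := M₀ φ N θ s (tangentVec φ θ ξ)
  have hcs : ⟪aVec φ N θ s v, x⟫ ^ 2 ≤ ‖aVec φ N θ s v‖ ^ 2 * ‖x‖ ^ 2 := by
    rw [← mul_pow, ← sq_abs]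
    gcongr
    exact abs_real_inner_le_norm _ _
  have hβ := beta_sq φ N θ s v
  have h3 : 0 ≤ beta φ N θ s v ^ 3 := (pow_pos (beta_pos ..) 3).le
  have h4 : beta φ N θ s v * ‖x‖ ^ 2 =
      beta φ N θ s v ^ 3 * ((1 + ‖aVec φ N θ s v‖ ^ 2) * ‖x‖ ^ 2) := by
    linear_combination -(beta φ N θ s v * ‖x‖ ^ 2) * hβ
  rw [h4]
  nlinarith [mul_le_mul_of_nonneg_left hcs h3]

/-- The ellipticity constant in terms of a bound `q` for `|s| ‖L‖` and a bound `R` for `|∇ρ|`. -/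
lemma ellipticity_of_norm_le (hL : ∀ i j, secondForm φ N θ i j = secondForm φ N θ j i)
    {q R : ℝ} (hq : q < 1) (hs : ‖s • weingarten φ N θ‖ ≤ q) (hv : ‖tangentVec φ θ v‖ ≤ R)
    (ξ : Fin m → ℝ) :
    (((1 + (R / (1 - q)) ^ 2) ^ (-(1 / 2) : ℝ)) ^ 3 / 4) * ‖tangentVec φ θ ξ‖ ^ 2 ≤
      ∑ i, ∑ j, coeff φ N θ s v i j * ξ i * ξ j := by
  have hA : IsUnit (1 - s • weingarten φ N θ) := isUnit_one_sub_of_norm_lt_one (hs.trans_lt hq)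
  have hbd : ∀ x : Amb m, ‖s • weingarten φ N θ x‖ ≤ q * ‖x‖ := fun x =>
    ((s • weingarten φ N θ).le_opNorm x).trans (by gcongr)
  have hM : ∀ x : Amb m, (1 - q) * ‖M₀ φ N θ s x‖ ≤ ‖x‖ := by
    intro x
    have h1 := norm_sub_norm_le (M₀ φ N θ s x) (s • weingarten φ N θ (M₀ φ N θ s x))
    rw [sub_weingarten_M₀ hA] at h1
    linarith [hbd (M₀ φ N θ s x)]
  -- From `|x| ≤ (1 + q)|M₀x|` and `q < 1`; squaring the factor 2 gives the 4 in the constant.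
  have hM' : ∀ x : Amb m, ‖x‖ ≤ 2 * ‖M₀ φ N θ s x‖ := by
    intro x
    have h1 := norm_sub_le (M₀ φ N θ s x) (s • weingarten φ N θ (M₀ φ N θ s x))
    rw [sub_weingarten_M₀ hA] at h1
    nlinarith [hbd (M₀ φ N θ s x), norm_nonneg (M₀ φ N θ s x)]
  have ha : ‖aVec φ N θ s v‖ ≤ R / (1 - q) := by
    rw [le_div_iff₀ (by linarith), mul_comm]
    exact (hM _).trans hv
  have hβ : (1 + (R / (1 - q)) ^ 2) ^ (-(1 / 2) : ℝ) ≤ beta φ N θ s v := by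
    refine Real.rpow_le_rpow_of_nonpos (by positivity) ?_ (by norm_num)
    gcongr
  refine le_trans ?_ (beta_pow_mul_norm_sq_le_sum_coeff hL hA ξ)
  have h1 : ‖tangentVec φ θ ξ‖ ^ 2 / 4 ≤ ‖M₀ φ N θ s (tangentVec φ θ ξ)‖ ^ 2 := by
    have := pow_le_pow_left₀ (norm_nonneg _) (hM' (tangentVec φ θ ξ)) 2
    linarith
  have h2 : ((1 + (R / (1 - q)) ^ 2) ^ (-(1 / 2) : ℝ)) ^ 3 ≤ beta φ N θ s v ^ 3 := by
    gcongr
  calc _ = ((1 + (R / (1 - q)) ^ 2) ^ (-(1 / 2) : ℝ)) ^ 3 * (‖tangentVec φ θ ξ‖ ^ 2 / 4) := by ring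
    _ ≤ _ := mul_le_mul h2 h1 (by positivity) (pow_pos (beta_pos ..) 3).le

end Hypersurf

/-! ### Calculus on regular patches. -/

namespace Hypersurf

/-! ### Partial derivatives -/

section PartialDerivatives

variable {m : ℕ} {F : Type*} [NormedAddCommGroup F] [NormedSpace ℝ F] {θ : Par m}

lemma contDiffAt_pd {k l : WithTop ℕ∞} {f : Par m → F} (hf : ContDiffAt ℝ l f θ)
    (hkl : k + 1 ≤ l) (i : Fin m) : ContDiffAt ℝ k (pd i f) θ :=
  (hf.fderiv_right hkl).clm_apply contDiffAt_const

lemma pd_congr {f g : Par m → F} (h : f =ᶠ[𝓝 θ] g) (i : Fin m) : pd i f θ = pd i g θ := by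
  rw [pd, pd, h.fderiv_eq]

lemma pd_add {f g : Par m → F} (hf : DifferentiableAt ℝ f θ) (hg : DifferentiableAt ℝ g θ)
    (i : Fin m) : pd i (fun η => f η + g η) θ = pd i f θ + pd i g θ := by
  rw [pd, fderiv_fun_add hf hg]
  rfl

lemma pd_sub {f g : Par m → F} (hf : DifferentiableAt ℝ f θ) (hg : DifferentiableAt ℝ g θ)
    (i : Fin m) : pd i (fun η => f η - g η) θ = pd i f θ - pd i g θ := by
  rw [pd, fderiv_fun_sub hf hg]
  rfl

lemma pd_smul {r : Par m → ℝ} {f : Par m → F} (hr : DifferentiableAt ℝ r θ)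
    (hf : DifferentiableAt ℝ f θ) (i : Fin m) :
    pd i (fun η => r η • f η) θ = r θ • pd i f θ + pd i r θ • f θ := by
  rw [pd, fderiv_fun_smul hr hf]
  rfl

lemma pd_inner {f g : Par m → Amb m} (hf : DifferentiableAt ℝ f θ)
    (hg : DifferentiableAt ℝ g θ) (i : Fin m) :
    pd i (fun η => ⟪f η, g η⟫) θ = ⟪f θ, pd i g θ⟫ + ⟪pd i f θ, g θ⟫ := by
  rw [pd, fderiv_inner_apply ℝ hf hg]
  rfl

lemma pd_const (c : F) (i : Fin m) : pd i (fun _ => c) θ = 0 := by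
  simp [pd]

lemma pd_comm {f : Par m → F} (hf : ContDiffAt ℝ 2 f θ) (i j : Fin m) :
    pd i (pd j f) θ = pd j (pd i f) θ := by
  have hd : DifferentiableAt ℝ (fderiv ℝ f) θ :=
    (hf.fderiv_right (m := 1) (by norm_num)).differentiableAt (by norm_num)
  have key : ∀ i j : Fin m, pd i (pd j f) θ =
      fderiv ℝ (fderiv ℝ f) θ (EuclideanSpace.single i 1) (EuclideanSpace.single j 1) := by
    intro i j
    have : pd j f = fun η => fderiv ℝ f η (EuclideanSpace.single j 1) := rfl
    rw [this, pd, fderiv_clm_apply hd (differentiableAt_const _)]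
    simp
  rw [key, key]
  exact hf.isSymmSndFDerivAt (by simp) _ _

lemma sum_smul_pd (f : Par m → F) (θ w : Par m) :
    ∑ i, w i • pd i f θ = fderiv ℝ f θ w := by
  simp only [pd, ← map_smul, ← map_sum]
  congr 1
  ext j
  simp [Pi.single_apply]

end PartialDerivatives

/-! ### Regularity of matrix inverses -/

section MatrixInverse

variable {E : Type*} [NormedAddCommGroup E] [NormedSpace ℝ E] {ι : Type*} [Fintype ι]
  [DecidableEq ι] {k : WithTop ℕ∞} {x : E}

lemma contDiffAt_det {A : E → Matrix ι ι ℝ} (hA : ∀ i j, ContDiffAt ℝ k (fun y => A y i j) x) :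
    ContDiffAt ℝ k (fun y => (A y).det) x := by
  simp only [Matrix.det_apply]
  refine ContDiffAt.sum fun σ _ => ?_
  simp only [Units.smul_def, zsmul_eq_mul]
  exact contDiffAt_const.mul (contDiffAt_prod fun i _ => hA _ _)

/-- By Cramer's rule the entries are quotients of determinants. -/
lemma contDiffAt_inv_apply {A : E → Matrix ι ι ℝ}
    (hA : ∀ i j, ContDiffAt ℝ k (fun y => A y i j) x) (hx : (A x).det ≠ 0) (i j : ι) :
    ContDiffAt ℝ k (fun y => (A y)⁻¹ i j) x := by
  have hEq : (fun y => (A y)⁻¹ i j) = fun y => ((A y).det)⁻¹ * (A y).adjugate i j := by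
    funext y
    rw [Matrix.inv_def, Ring.inverse_eq_inv']
    rfl
  rw [hEq]
  refine ((contDiffAt_det hA).inv hx).mul ?_
  simp only [Matrix.adjugate_apply]
  refine contDiffAt_det fun a b => ?_
  simp only [Matrix.updateRow_apply]
  split_ifs
  · exact contDiffAt_const
  · exact hA a b

end MatrixInverse

/-! ### Regular parametrized hypersurfaces -/

/-- `φ` is a regular parametrization of class `C³` with unit normal field `N` of class `C²`. -/
structure IsRegularPatch {m : ℕ} (U : Set (Par m)) (φ N : Par m → Amb m) : Prop where
  isOpen : IsOpen U
  contDiffOn_param : ContDiffOn ℝ 3 φ U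
  contDiffOn_normal : ContDiffOn ℝ 2 N U
  isFrame : ∀ θ ∈ U, IsFrame φ θ (N θ)

namespace IsRegularPatch

variable {m : ℕ} {U : Set (Par m)} {φ N : Par m → Amb m} {θ : Par m}

section Basic

variable (h : IsRegularPatch U φ N) (hθ : θ ∈ U)

include h hθ

lemma contDiffAt_param : ContDiffAt ℝ 3 φ θ :=
  h.contDiffOn_param.contDiffAt (h.isOpen.mem_nhds hθ)

lemma contDiffAt_normal : ContDiffAt ℝ 2 N θ :=
  h.contDiffOn_normal.contDiffAt (h.isOpen.mem_nhds hθ)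

lemma contDiffAt_tau (i : Fin m) : ContDiffAt ℝ 2 (tau φ i) θ :=
  contDiffAt_pd (h.contDiffAt_param hθ) (by norm_num) i

lemma contDiffAt_tauDual (i : Fin m) : ContDiffAt ℝ 2 (tauDual φ i) θ := by
  refine ContDiffAt.sum fun k _ => ContDiffAt.fun_smul ?_ (h.contDiffAt_tau hθ k)
  refine contDiffAt_inv_apply
    (fun i j => (h.contDiffAt_tau hθ i).inner ℝ (h.contDiffAt_tau hθ j)) ?_ i k
  exact (Matrix.posDef_gram_of_linearIndependent (h.isFrame θ hθ).linearIndependent).det_pos.ne'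

lemma contDiffAt_secondForm (i j : Fin m) :
    ContDiffAt ℝ 1 (fun η => secondForm φ N η i j) θ :=
  (contDiffAt_pd (h.contDiffAt_tau hθ j) (by norm_num) i).inner ℝ
    ((h.contDiffAt_normal hθ).of_le (by norm_num))

lemma contDiffAt_weingarten : ContDiffAt ℝ 1 (weingarten φ N) θ := by
  refine ContDiffAt.sum fun i _ => ContDiffAt.sum fun j _ => ?_
  refine (h.contDiffAt_secondForm hθ i j).smul ?_
  have hd : ∀ i, ContDiffAt ℝ 1 (tauDual φ i) θ := fun i =>
    (h.contDiffAt_tauDual hθ i).of_le (by norm_num)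
  simp only [InnerProductSpace.rankOne_def]
  exact ContDiffAt.smulRight ((innerSL ℝ).contDiff.contDiffAt.comp θ (hd j)) (hd i)

lemma secondForm_symm (i j : Fin m) : secondForm φ N θ i j = secondForm φ N θ j i := by
  rw [secondForm, Matrix.of_apply, Matrix.of_apply,
    pd_comm ((h.contDiffAt_param hθ).of_le (by norm_num))]

/-- The Weingarten equation. -/
lemma pd_normal (i : Fin m) : pd i N θ = -weingarten φ N θ (tau φ i θ) := by
  have hf := h.isFrame θ hθ
  have hN := (h.contDiffAt_normal hθ).differentiableAt (by norm_num)
  have hU := h.isOpen.mem_nhds hθ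
  rw [← sub_eq_zero, sub_neg_eq_add]
  refine hf.eq_zero_of_orthogonal (fun j => ?_) ?_
  · have h1 : pd i (fun η => ⟪N η, tau φ j η⟫) θ = 0 := by
      rw [← pd_const (θ := θ) (0 : ℝ) i]
      refine pd_congr ?_ i
      filter_upwards [hU] with η hη using (h.isFrame η hη).inner_tau j
    rw [pd_inner hN ((h.contDiffAt_tau hθ j).differentiableAt (by norm_num))] at h1
    rw [inner_add_left, inner_weingarten_comm (h.secondForm_symm hθ),
      inner_tau_weingarten_tau hf.linearIndependent, secondForm, Matrix.of_apply,
      real_inner_comm, add_comm]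
    rw [real_inner_comm] at h1
    rw [real_inner_comm (pd i N θ)]
    exact h1
  · have h1 : pd i (fun η => ⟪N η, N η⟫) θ = 0 := by
      rw [← pd_const (θ := θ) (1 : ℝ) i]
      refine pd_congr ?_ i
      filter_upwards [hU] with η hη using (h.isFrame η hη).inner_self
    rw [pd_inner hN hN, real_inner_comm] at h1
    rw [inner_add_left, real_inner_comm (N θ) (weingarten _ _ _ _), hf.inner_normal_weingarten]
    linarith

end Basic

/-! ### Regularity in the independent variables `(θ, s, v)`. -/

section Joint

variable {x : Par m × ℝ × (Fin m → ℝ)} (h : IsRegularPatch U φ N) (hx : x.1 ∈ U)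

include h hx

lemma contDiffAt_tangentVec :
    ContDiffAt ℝ 1 (fun y : Par m × ℝ × (Fin m → ℝ) => tangentVec φ y.1 y.2.2) x := by
  refine ContDiffAt.sum fun i _ => ContDiffAt.fun_smul ?_ ?_
  · exact (contDiff_apply ℝ ℝ i).contDiffAt.comp x (contDiffAt_snd.comp x contDiffAt_snd)
  · exact ((h.contDiffAt_tauDual hx i).of_le (by norm_num)).comp x contDiffAt_fst

variable (hA : IsUnit (1 - x.2.1 • weingarten φ N x.1))

include hA

lemma contDiffAt_M₀ :
    ContDiffAt ℝ 1 (fun y : Par m × ℝ × (Fin m → ℝ) => M₀ φ N y.1 y.2.1) x := by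
  obtain ⟨u, hu⟩ := hA
  have h1 : ContDiffAt ℝ 1
      (fun y : Par m × ℝ × (Fin m → ℝ) => 1 - y.2.1 • weingarten φ N y.1) x :=
    contDiffAt_const.sub ((contDiffAt_fst.comp x contDiffAt_snd).smul
      ((h.contDiffAt_weingarten hx).comp x contDiffAt_fst))
  refine ContDiffAt.comp (g := Ring.inverse) x ?_ h1
  rw [← hu]
  exact contDiffAt_ringInverse ℝ u

lemma contDiffAt_aVec :
    ContDiffAt ℝ 1 (fun y : Par m × ℝ × (Fin m → ℝ) => aVec φ N y.1 y.2.1 y.2.2) x :=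
  (h.contDiffAt_M₀ hx hA).clm_apply (h.contDiffAt_tangentVec hx)

lemma contDiffAt_beta :
    ContDiffAt ℝ 1 (fun y : Par m × ℝ × (Fin m → ℝ) => beta φ N y.1 y.2.1 y.2.2) x := by
  refine ContDiffAt.rpow_const_of_ne
    (contDiffAt_const.add ((h.contDiffAt_aVec hx hA).norm_sq ℝ)) ?_
  positivity

lemma contDiffAt_coeff (i j : Fin m) :
    ContDiffAt ℝ 1 (fun y : Par m × ℝ × (Fin m → ℝ) => coeff φ N y.1 y.2.1 y.2.2 i j) x := by
  have hd : ∀ i, ContDiffAt ℝ 1 (fun y : Par m × ℝ × (Fin m → ℝ) => tauDual φ i y.1) x :=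
    fun i => ((h.contDiffAt_tauDual hx i).of_le (by norm_num)).comp x contDiffAt_fst
  have hM := h.contDiffAt_M₀ hx hA
  have hβ := h.contDiffAt_beta hx hA
  have hM2 : ContDiffAt ℝ 1 (fun y : Par m × ℝ × (Fin m → ℝ) =>
      (M₀ φ N y.1 y.2.1 ^ 2) (tangentVec φ y.1 y.2.2)) x :=
    (hM.pow 2).clm_apply (h.contDiffAt_tangentVec hx)
  exact (hβ.mul ((hd i).inner ℝ ((hM.pow 2).clm_apply (hd j)))).sub
    (((hβ.pow 3).mul (hM2.inner ℝ (hd i))).mul (hM2.inner ℝ (hd j)))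

/-- The lower-order part of the curvature operator. -/
lemma continuousAt_lowerOrder :
    ContinuousAt (fun y : Par m × ℝ × (Fin m → ℝ) =>
      ∑ i, ∑ j, coeff φ N y.1 y.2.1 y.2.2 i j *
        ⟪pd i (pd j φ) y.1 + (y.2.2 j • pd i N y.1 + y.2.2 i • pd j N y.1
          + y.2.1 • pd i (pd j N) y.1), N y.1 - aVec φ N y.1 y.2.1 y.2.2⟫) x := by
  refine tendsto_finsetSum _ fun i _ => tendsto_finsetSum _ fun j _ => ?_
  have hN := h.contDiffAt_normal hx
  have hfst : ContinuousAt (fun y : Par m × ℝ × (Fin m → ℝ) => y.1) x := continuousAt_fst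
  have hv : ∀ i, ContinuousAt (fun y : Par m × ℝ × (Fin m → ℝ) => y.2.2 i) x := fun i => by
    fun_prop
  have hs : ContinuousAt (fun y : Par m × ℝ × (Fin m → ℝ) => y.2.1) x := by fun_prop
  have hφ2 : ContinuousAt (fun y : Par m × ℝ × (Fin m → ℝ) => pd i (pd j φ) y.1) x :=
    ContinuousAt.comp (f := fun y : Par m × ℝ × (Fin m → ℝ) => y.1)
      (contDiffAt_pd (k := 1) (h.contDiffAt_tau hx j) (by norm_num) i).continuousAt hfst
  have hN1 : ∀ i, ContinuousAt (fun y : Par m × ℝ × (Fin m → ℝ) => pd i N y.1) x := fun i =>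
    ContinuousAt.comp (f := fun y : Par m × ℝ × (Fin m → ℝ) => y.1)
      (contDiffAt_pd (k := 1) hN (by norm_num) i).continuousAt hfst
  -- Since `N` is assumed only `C²`, this term is merely continuous.
  have hN2 : ContinuousAt (fun y : Par m × ℝ × (Fin m → ℝ) => pd i (pd j N) y.1) x :=
    ContinuousAt.comp (f := fun y : Par m × ℝ × (Fin m → ℝ) => y.1)
      (contDiffAt_pd (k := 0) (contDiffAt_pd (k := 1) hN (by norm_num) j)
        (by norm_num) i).continuousAt hfst
  have hN0 : ContinuousAt (fun y : Par m × ℝ × (Fin m → ℝ) => N y.1) x :=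
    ContinuousAt.comp (f := fun y : Par m × ℝ × (Fin m → ℝ) => y.1) hN.continuousAt hfst
  refine ContinuousAt.mul (h.contDiffAt_coeff hx hA i j).continuousAt ?_
  exact (hφ2.add ((((hv j).smul (hN1 i)).add ((hv i).smul (hN1 j))).add (hs.smul hN2))).inner
    (hN0.sub (h.contDiffAt_aVec hx hA).continuousAt)

end Joint

/-! ### The normal graph `φ + r N` -/

section Graph

variable {r : Par m → ℝ} (h : IsRegularPatch U φ N) (hr : ContDiffOn ℝ 2 r U)

include h hr

lemma contDiffOn_gammaParam : ContDiffOn ℝ 2 (gammaParam φ N r) U :=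
  (h.contDiffOn_param.of_le (by norm_num)).add (hr.smul h.contDiffOn_normal)

lemma contDiffAt_grad (hθ : θ ∈ U) : ContDiffAt ℝ 1 (grad r) θ :=
  contDiffAt_pi.mpr fun i =>
    contDiffAt_pd (hr.contDiffAt (h.isOpen.mem_nhds hθ)) (by norm_num) i

lemma contDiffAt_aField (hθ : θ ∈ U) (hA : IsUnit (1 - r θ • weingarten φ N θ)) :
    ContDiffAt ℝ 1 (aField φ N r) θ :=
  ContDiffAt.comp (f := fun η => (η, r η, grad r η)) θ
    (h.contDiffAt_aVec (x := (θ, r θ, grad r θ)) hθ hA)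
    (contDiffAt_id.prodMk (((hr.contDiffAt (h.isOpen.mem_nhds hθ)).of_le (by norm_num)).prodMk
      (h.contDiffAt_grad hr hθ)))

lemma pd_gammaParam (hθ : θ ∈ U) (i : Fin m) :
    pd i (gammaParam φ N r) θ = pd i φ θ + (r θ • pd i N θ + pd i r θ • N θ) := by
  have hφ := (h.contDiffAt_param hθ).differentiableAt (by norm_num)
  have hN := (h.contDiffAt_normal hθ).differentiableAt (by norm_num)
  have hr1 := (hr.contDiffAt (h.isOpen.mem_nhds hθ)).differentiableAt (by norm_num)
  have : gammaParam φ N r = fun η => φ η + r η • N η := rfl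
  rw [this, pd_add hφ (hr1.fun_smul hN), pd_smul hr1 hN]

lemma pd_pd_gammaParam (hθ : θ ∈ U) (i j : Fin m) :
    pd i (pd j (gammaParam φ N r)) θ = pd i (pd j φ) θ +
      (pd j r θ • pd i N θ + pd i r θ • pd j N θ + r θ • pd i (pd j N) θ)
        + pd i (pd j r) θ • N θ := by
  have hcr := hr.contDiffAt (h.isOpen.mem_nhds hθ)
  have hφ := (h.contDiffAt_tau hθ j).differentiableAt (by norm_num)
  have hN := (h.contDiffAt_normal hθ).differentiableAt (by norm_num)
  have hN1 := (contDiffAt_pd (k := 1) (h.contDiffAt_normal hθ) (by norm_num) j).differentiableAt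
    (by norm_num)
  have hr1 := hcr.differentiableAt (by norm_num)
  have hr2 := (contDiffAt_pd (k := 1) hcr (by norm_num) j).differentiableAt (by norm_num)
  have hev : pd j (gammaParam φ N r) =ᶠ[𝓝 θ]
      fun η => tau φ j η + (r η • pd j N η + pd j r η • N η) := by
    filter_upwards [h.isOpen.mem_nhds hθ] with η hη using h.pd_gammaParam hr hη j
  rw [pd_congr hev, pd_add hφ ((hr1.fun_smul hN1).fun_add (hr2.fun_smul hN)),
    pd_add (hr1.fun_smul hN1) (hr2.fun_smul hN), pd_smul hr1 hN1, pd_smul hr2 hN]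
  change pd i (pd j φ) θ + _ = _
  abel

lemma hasGraphTangents (hθ : θ ∈ U) :
    HasGraphTangents φ N (gammaParam φ N r) θ (r θ) (grad r θ) := by
  intro i
  rw [tau, h.pd_gammaParam hr hθ, h.pd_normal hθ, smul_neg, ← add_assoc, ← sub_eq_add_neg]
  rfl

/-- The quasilinear form of the mean curvature of a normal graph. -/
lemma meanCurvature_gammaParam (hθ : θ ∈ U) (hA : IsUnit (1 - r θ • weingarten φ N θ))
    {NΓ : Par m → Amb m} (hN : IsUnitNormalAt (gammaParam φ N r) (N θ) θ (NΓ θ)) :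
    meanCurvature (gammaParam φ N r) NΓ θ =
      (∑ i, ∑ j, coeff φ N θ (r θ) (grad r θ) i j * pd i (pd j r) θ) +
        ∑ i, ∑ j, coeff φ N θ (r θ) (grad r θ) i j *
          ⟪pd i (pd j φ) θ + (grad r θ j • pd i N θ + grad r θ i • pd j N θ
            + r θ • pd i (pd j N) θ), N θ - aVec φ N θ (r θ) (grad r θ)⟫ := by
  have hf := h.isFrame θ hθ
  rw [(h.hasGraphTangents hr hθ).meanCurvature_eq hf (h.secondForm_symm hθ) hA hN,
    ← Finset.sum_add_distrib]
  refine Finset.sum_congr rfl fun i _ => ?_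
  rw [← Finset.sum_add_distrib]
  refine Finset.sum_congr rfl fun j _ => ?_
  -- Here `(N | N - a) = 1` makes the coefficient of `∂ᵢ∂ⱼr` exactly `cⁱʲ`.
  rw [h.pd_pd_gammaParam hr hθ, inner_add_left _ (pd i (pd j r) θ • N θ),
    real_inner_smul_left (N θ), inner_sub_right (N θ), hf.inner_self, hf.inner_normal_aVec hA]
  simp only [grad]
  ring

/-- The curvature formula for a normal graph. -/
lemma meanCurvature_eq_curvatureFormula (hA : ∀ η ∈ U, IsUnit (1 - r η • weingarten φ N η))
    (hθ : θ ∈ U) {NΓ : Par m → Amb m}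
    (hN : IsUnitNormalAt (gammaParam φ N r) (N θ) θ (NΓ θ)) :
    meanCurvature (gammaParam φ N r) NΓ θ = curvatureFormula φ N r θ := by
  have hf := h.isFrame θ hθ
  have hU := h.isOpen.mem_nhds hθ
  have ha := (h.contDiffAt_aField hr hθ (hA θ hθ)).differentiableAt (by norm_num)
  have hNd := (h.contDiffAt_normal hθ).differentiableAt (by norm_num)
  have hψ : ∀ j, DifferentiableAt ℝ (pd j (gammaParam φ N r)) θ := fun j =>
    (contDiffAt_pd (k := 1) ((h.contDiffOn_gammaParam hr).contDiffAt hU)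
      (by norm_num) j).differentiableAt (by norm_num)
  have hgt := h.hasGraphTangents hr hθ
  rw [hgt.meanCurvature_eq hf (h.secondForm_symm hθ) (hA θ hθ) hN, curvatureFormula,
    surfaceGradVec]
  -- Differentiate `(N | a) = 0`.
  have hb : ∀ i, ⟪N θ, pd i (aField φ N r) θ⟫ =
      ⟪weingarten φ N θ (tau φ i θ), aVec φ N θ (r θ) (grad r θ)⟫ := by
    intro i
    have h1 : pd i (fun η => ⟪N η, aField φ N r η⟫) θ = 0 := by
      rw [← pd_const (θ := θ) (0 : ℝ) i]
      refine pd_congr ?_ i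
      filter_upwards [hU] with η hη using (h.isFrame η hη).inner_normal_aVec (hA η hη) _
    rw [pd_inner hNd ha, h.pd_normal hθ, inner_neg_left, ← sub_eq_add_neg, sub_eq_zero] at h1
    exact h1
  refine Eq.trans ?_ (hgt.sum_coeff_mul_inner hf (h.secondForm_symm hθ) (hA θ hθ) hb)
  refine Finset.sum_congr rfl fun i _ => Finset.sum_congr rfl fun j _ => ?_
  congr 1
  -- Differentiating the orthogonality of `∂ⱼψ` and `N - a` trades `∂ᵢ∂ⱼψ` for `∂ᵢ(N - a) = -(Lτᵢ +
  -- ∂ᵢa)`.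
  have h2 : pd i (fun η => ⟪pd j (gammaParam φ N r) η, N η - aField φ N r η⟫) θ = 0 := by
    rw [← pd_const (θ := θ) (0 : ℝ) i]
    refine pd_congr ?_ i
    filter_upwards [hU] with η hη
    have h3 := ((h.hasGraphTangents hr hη).isFrame (h.isFrame η hη) (h.secondForm_symm hη)
      (hA η hη)).inner_tau j
    rw [real_inner_smul_left] at h3
    rw [real_inner_comm]
    exact (mul_eq_zero.mp h3).resolve_left (beta_pos ..).ne'
  rw [pd_inner (hψ j) (hNd.fun_sub ha), pd_sub hNd ha, h.pd_normal hθ, ← neg_add', inner_neg_right,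
    neg_add_eq_zero] at h2
  exact h2.symm

end Graph

end IsRegularPatch

end Hypersurf

/-! ### From patches to the closed hypersurface. -/

namespace Hypersurf

variable {m : ℕ} {k : WithTop ℕ∞} {Ω S : Set (Amb m)} {Φ : Flattening m} {θ : Par m}

/-! ### Charts -/

lemma isOpen_paramSet (Φ : Flattening m) : IsOpen (paramSet Φ) :=
  Φ.open_target.preimage (by fun_prop : Continuous fun θ : Par m => (θ, (0 : ℝ)))

lemma param_mem_source (hθ : θ ∈ paramSet Φ) : param Φ θ ∈ Φ.source := Φ.map_target hθ

lemma apply_param (hθ : θ ∈ paramSet Φ) : Φ (param Φ θ) = (θ, 0) := Φ.right_inv hθ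

namespace IsChart

variable (hΦ : IsChart k S Φ)

include hΦ

lemma param_mem (hθ : θ ∈ paramSet Φ) : param Φ θ ∈ S := by
  rw [hΦ.mem_iff _ (param_mem_source hθ), apply_param hθ]

lemma mk_fst_mem_target {x : Amb m} (hx : x ∈ Φ.source) (hxS : x ∈ S) :
    (Φ x).1 ∈ paramSet Φ := by
  have h1 : ((Φ x).1, (0 : ℝ)) = Φ x := Prod.ext rfl ((hΦ.mem_iff x hx).mp hxS).symm
  rw [paramSet, Set.mem_ofPred_eq, h1]
  exact Φ.map_source hx

lemma param_fst {x : Amb m} (hx : x ∈ Φ.source) (hxS : x ∈ S) : param Φ (Φ x).1 = x := by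
  have h1 : ((Φ x).1, (0 : ℝ)) = Φ x := Prod.ext rfl ((hΦ.mem_iff x hx).mp hxS).symm
  rw [param, h1, Φ.left_inv hx]

lemma contDiffOn_param : ContDiffOn ℝ k (param Φ) (paramSet Φ) :=
  hΦ.contDiffOn_symm.comp (contDiff_id.prodMk contDiff_const).contDiffOn fun _ h => h

lemma contDiffAt_param (hθ : θ ∈ paramSet Φ) : ContDiffAt ℝ k (param Φ) θ :=
  hΦ.contDiffOn_param.contDiffAt ((isOpen_paramSet Φ).mem_nhds hθ)

lemma contDiffAt {x : Amb m} (hx : x ∈ Φ.source) : ContDiffAt ℝ k Φ x :=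
  hΦ.contDiffOn.contDiffAt (Φ.open_source.mem_nhds hx)

/-- The first component of `Φ` is a left inverse of the parametrization, whose derivative is
therefore injective. -/
lemma linearIndependent_tau (hk : k ≠ 0) (hθ : θ ∈ paramSet Φ) :
    LinearIndependent ℝ fun i => tau (param Φ) i θ := by
  have hcomp : HasFDerivAt (fun η => (Φ (param Φ η)).1)
      (((ContinuousLinearMap.fst ℝ (Par m) ℝ).comp (fderiv ℝ Φ (param Φ θ))).comp
        (fderiv ℝ (param Φ) θ)) θ :=
    (((hΦ.contDiffAt (param_mem_source hθ)).differentiableAt hk).hasFDerivAt.fst).comp θ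
      ((hΦ.contDiffAt_param hθ).differentiableAt hk).hasFDerivAt
  have hid : (fun η => (Φ (param Φ η)).1) =ᶠ[𝓝 θ] id := by
    filter_upwards [(isOpen_paramSet Φ).mem_nhds hθ] with η hη
    rw [apply_param hη, id]
  have hEq := (hcomp.congr_of_eventuallyEq hid.symm).unique (hasFDerivAt_id θ)
  rw [Fintype.linearIndependent_iff]
  intro c hc i
  have h1 : fderiv ℝ (param Φ) θ (WithLp.toLp 2 c) = 0 := by
    rw [← sum_smul_pd]
    exact hc
  have h2 := congrArg (fun T : Par m →L[ℝ] Par m => T (WithLp.toLp 2 c)) hEq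
  simp only [ContinuousLinearMap.comp_apply, h1, map_zero] at h2
  exact (congrArg (fun w : Par m => w i) h2).symm

end IsChart

/-! ### The outer unit normal -/

/-- The gradient of a scalar function in Cartesian coordinates. -/
noncomputable def cartesianGrad (f : Amb m → ℝ) (x : Amb m) : Amb m :=
  ∑ i, fderiv ℝ f x (EuclideanSpace.single i 1) • EuclideanSpace.single i 1

lemma inner_cartesianGrad (f : Amb m → ℝ) (x y : Amb m) :
    ⟪cartesianGrad f x, y⟫ = fderiv ℝ f x y := by
  have hy : y = ∑ i, y i • EuclideanSpace.single i (1 : ℝ) := by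
    ext j
    simp [Pi.single_apply]
  conv_rhs => rw [hy, map_sum]
  rw [cartesianGrad, sum_inner]
  refine Finset.sum_congr rfl fun i _ => ?_
  rw [real_inner_smul_left, map_smul, EuclideanSpace.inner_single_left, smul_eq_mul]
  simp [mul_comm]

lemma contDiffAt_cartesianGrad {f : Amb m → ℝ} {x : Amb m} (hf : ContDiffAt ℝ 3 f x) :
    ContDiffAt ℝ 2 (cartesianGrad f) x :=
  ContDiffAt.sum fun _ _ =>
    (((hf.fderiv_right (by norm_num)).clm_apply contDiffAt_const).smul contDiffAt_const)

/-- With `E` the inverse of the derivative of `Φ`, the tangent space is `E(ℝⁿ⁻¹ × {0})`. A vector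
orthogonal to it sees only the last component of the derivative, with factor `⟪w, E(0, 1)⟫`. -/
lemma IsChart.eq_smul_cartesianGrad (hΦ : IsChart k S Φ) (hk : k ≠ 0) {q w : Amb m}
    (hq : q ∈ Φ.source) (hqS : q ∈ S) (hw : ∀ i, ⟪w, tau (param Φ) i (Φ q).1⟫ = 0) :
    ∃ c : ℝ, w = c • cartesianGrad (fun x => (Φ x).2) q := by
  set E := fderiv ℝ Φ.symm (Φ q)
  have hθ := hΦ.mk_fst_mem_target hq hqS
  have hpt : ((Φ q).1, (0 : ℝ)) = Φ q := Prod.ext rfl ((hΦ.mem_iff q hq).mp hqS).symm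
  have hΦd := ((hΦ.contDiffAt hq).differentiableAt hk).hasFDerivAt
  have hEd : HasFDerivAt Φ.symm E (Φ q) :=
    ((hΦ.contDiffOn_symm.contDiffAt
      (Φ.open_target.mem_nhds (Φ.map_source hq))).differentiableAt hk).hasFDerivAt
  have hED : ∀ y, E (fderiv ℝ Φ q y) = y := by
    have hev : (fun x => Φ.symm (Φ x)) =ᶠ[𝓝 q] id := by
      filter_upwards [Φ.open_source.mem_nhds hq] with x hx using Φ.left_inv hx
    have hEq := ((hEd.comp q hΦd).congr_of_eventuallyEq hev.symm).unique (hasFDerivAt_id q)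
    exact fun y => congrArg (fun T : Amb m →L[ℝ] Amb m => T y) hEq
  have hpar : fderiv ℝ (param Φ) (Φ q).1 = E.comp (ContinuousLinearMap.inl ℝ (Par m) ℝ) := by
    refine HasFDerivAt.fderiv ?_
    refine HasFDerivAt.comp (g := Φ.symm) (Φ q).1 ?_ (hasFDerivAt_prodMk_left _ _)
    rw [hpt]
    exact hEd
  have htan : ∀ u : Par m, ⟪w, E (u, 0)⟫ = 0 := by
    intro u
    have h1 : E (u, 0) = fderiv ℝ (param Φ) (Φ q).1 u := by
      rw [hpar]
      rfl
    rw [h1, ← sum_smul_pd, inner_sum]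
    refine Finset.sum_eq_zero fun i _ => ?_
    rw [real_inner_smul_right]
    exact mul_eq_zero_of_right _ (hw i)
  refine ⟨⟪w, E (0, 1)⟫, ext_inner_right ℝ fun y => ?_⟩
  have h2 : fderiv ℝ (fun x => (Φ x).2) q y = (fderiv ℝ Φ q y).2 := by
    rw [hΦd.snd.fderiv]
    rfl
  rw [real_inner_smul_left, inner_cartesianGrad, h2]
  have h3 : fderiv ℝ Φ q y =
      ((fderiv ℝ Φ q y).1, (0 : ℝ)) + (fderiv ℝ Φ q y).2 • ((0 : Par m), (1 : ℝ)) := by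
    ext <;> simp
  conv_lhs => rw [← hED y, h3, map_add, map_smul, inner_add_right, htan, real_inner_smul_right]
  ring

lemma IsOuterNormal.eq_normalize_cartesianGrad {ν : Amb m → Amb m} (hν : IsOuterNormal k Ω S ν)
    (hk : k ≠ 0) (hΦ : IsChart k S Φ) (hside : ∀ x ∈ Φ.source, x ∈ Ω ↔ (Φ x).2 < 0) {q : Amb m}
    (hq : q ∈ Φ.source) (hqS : q ∈ S) :
    cartesianGrad (fun x => (Φ x).2) q ≠ 0 ∧
      ν q = ‖cartesianGrad (fun x => (Φ x).2) q‖⁻¹ • cartesianGrad (fun x => (Φ x).2) q := by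
  obtain ⟨hν1, hν2, hν3⟩ := hν q hqS
  obtain ⟨c, hc⟩ := hΦ.eq_smul_cartesianGrad hk hq hqS
    (hν2 Φ hΦ _ (hΦ.mk_fst_mem_target hq hqS) (hΦ.param_fst hq hqS))
  set G := cartesianGrad (fun x => (Φ x).2) q with hG
  have hG0 : G ≠ 0 := by
    intro h0
    rw [hc, h0, smul_zero, norm_zero] at hν1
    exact zero_ne_one hν1
  have hf : HasFDerivAt (fun x => (Φ x).2) (fderiv ℝ (fun x => (Φ x).2) q) q :=
    ((hΦ.contDiffAt hq).differentiableAt hk).snd.hasFDerivAt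
  have hline : HasDerivAt (fun t : ℝ => q - t • ν q) (-ν q) 0 := by
    simpa using ((hasDerivAt_id (0 : ℝ)).smul_const (ν q)).const_sub q
  have hder : HasDerivAt (fun t : ℝ => (Φ (q - t • ν q)).2) (-⟪G, ν q⟫) 0 := by
    have h1 := HasFDerivAt.comp_hasDerivAt (0 : ℝ) (f := fun t : ℝ => q - t • ν q)
      (l := fun x => (Φ x).2) (by simpa using hf) hline
    rw [map_neg, ← inner_cartesianGrad] at h1
    exact h1
  have hcont : ∀ᶠ t in 𝓝[>] (0 : ℝ), q - t • ν q ∈ Φ.source := by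
    have : Filter.Tendsto (fun t : ℝ => q - t • ν q) (𝓝[>] 0) (𝓝 q) := by
      have := hline.continuousAt.tendsto
      simp only [zero_smul, sub_zero] at this
      exact this.mono_left nhdsWithin_le_nhds
    exact this (Φ.open_source.mem_nhds hq)
  -- The sign of `c` comes from the side: points `q - tν` lie in `Ω`, where the last chart component
  -- is negative, while it vanishes at `q`.
  have hle : -⟪G, ν q⟫ ≤ 0 := by
    have hsub : Set.Ioi (0 : ℝ) ⊆ {0}ᶜ := fun t ht => (Set.mem_Ioi.mp ht).ne'
    have hs := (hasDerivAt_iff_tendsto_slope.mp hder).mono_left (nhdsWithin_mono (0 : ℝ) hsub)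
    refine le_of_tendsto hs ?_
    filter_upwards [hν3, hcont, self_mem_nhdsWithin] with t ht hts htpos
    have h1 := (hside _ hts).mp ht.1
    have h2 : (Φ q).2 = 0 := (hΦ.mem_iff q hq).mp hqS
    rw [slope_def_field]
    simp only [zero_smul, sub_zero, h2]
    exact (div_neg_of_neg_of_pos h1 htpos).le
  have hcpos : 0 ≤ c := by
    rw [hc, real_inner_smul_right, real_inner_self_eq_norm_sq] at hle
    have hpos : 0 < ‖G‖ ^ 2 := by positivity
    nlinarith
  refine ⟨hG0, ?_⟩
  rw [hc, norm_smul, Real.norm_eq_abs, abs_of_nonneg hcpos] at hν1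
  rw [hc, ← eq_inv_of_mul_eq_one_left hν1]

/-- An arbitrary chart need not have `Ω` on its negative side, so the regularity of the normal is
read off from a second, one-sided chart `Φ₀`; its `C³` regularity makes the gradient `C²`. -/
lemma IsClosedHypersurface.isRegularPatch (hS : IsClosedHypersurface k Ω S) (hk : 3 ≤ k)
    {ν : Amb m → Amb m} (hν : IsOuterNormal k Ω S ν) (hΦ : IsChart k S Φ) :
    IsRegularPatch (paramSet Φ) (param Φ) (ν ∘ param Φ) where
  isOpen := isOpen_paramSet Φ
  contDiffOn_param := hΦ.contDiffOn_param.of_le hk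
  contDiffOn_normal := by
    have hk0 : k ≠ 0 := by
      rintro rfl
      simp at hk
    intro θ hθ
    obtain ⟨Φ₀, hΦ₀, hp, hside⟩ := hS.exists_chart _ (hΦ.param_mem hθ)
    have hG := hν.eq_normalize_cartesianGrad hk0 hΦ₀ hside hp (hΦ.param_mem hθ)
    have hg : ContDiffAt ℝ 2 (fun η => cartesianGrad (fun x => (Φ₀ x).2) (param Φ η)) θ :=
      (contDiffAt_cartesianGrad ((hΦ₀.contDiffAt hp).of_le hk).snd).comp θ
        ((hΦ.contDiffAt_param hθ).of_le (le_trans (by norm_num) hk))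
    refine ContDiffAt.contDiffWithinAt ?_
    refine (((hg.norm ℝ hG.1).inv (norm_ne_zero_iff.mpr hG.1)).smul hg).congr_of_eventuallyEq ?_
    filter_upwards [(isOpen_paramSet Φ).mem_nhds hθ,
      (hΦ.contDiffAt_param hθ).continuousAt.preimage_mem_nhds (Φ₀.open_source.mem_nhds hp)]
      with η hη hη'
    exact (hν.eq_normalize_cartesianGrad hk0 hΦ₀ hside hη' (hΦ.param_mem hη)).2
  isFrame θ hθ :=
    { linearIndependent := hΦ.linearIndependent_tau (by rintro rfl; simp at hk) hθ
      norm_eq_one := (hν _ (hΦ.param_mem hθ)).1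
      inner_tau := (hν _ (hΦ.param_mem hθ)).2.1 Φ hΦ θ hθ rfl }

/-! ### Bounds by the principal curvatures -/

/-- With `K` the supremum of the `|κ|`, symmetry gives `‖L‖ ≤ K`, and `q = s₁K < 1` serves all
charts. The strict bound on `s₁` also excludes `K = ∞`. -/
lemma exists_norm_smul_weingarten_le {ν : Amb m → Amb m}
    (hreg : ∀ Φ, IsChart k S Φ → IsRegularPatch (paramSet Φ) (param Φ) (ν ∘ param Φ))
    {s₁ : ℝ≥0} (hs : (s₁ : ℝ≥0∞) < rhoBound k S ν) :
    ∃ q < (1 : ℝ), ∀ Φ, IsChart k S Φ → ∀ θ ∈ paramSet Φ, ∀ s : ℝ, |s| ≤ s₁ →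
      ‖s • weingarten (param Φ) (ν ∘ param Φ) θ‖ ≤ q := by
  set K : ℝ≥0∞ := ⨆ κ ∈ principalCurvatures k S ν, ‖κ‖ₑ with hK
  have hs' : (s₁ : ℝ≥0∞) < K⁻¹ := hs
  have hKtop : K ≠ ⊤ := by
    intro h
    rw [h, ENNReal.inv_top] at hs'
    exact not_lt_bot hs'
  refine ⟨s₁ * K.toReal, ?_, fun Φ hΦ θ hθ s hs₁ => ?_⟩
  · have h1 : (s₁ : ℝ≥0∞) * K < 1 := ENNReal.mul_lt_of_lt_div (by rwa [one_div])
    have h2 := (ENNReal.toReal_lt_toReal (ne_top_of_lt h1) ENNReal.one_ne_top).mpr h1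
    simpa [ENNReal.toReal_mul] using h2
  · have hL : ‖weingarten (param Φ) (ν ∘ param Φ) θ‖ ≤ K.toReal := by
      refine norm_le_of_forall_eigenvalue
        (inner_weingarten_comm ((hreg Φ hΦ).secondForm_symm hθ)) ENNReal.toReal_nonneg ?_
      intro c hc x hx hcx
      have hmem : c ∈ principalCurvatures k S ν :=
        ⟨Φ, hΦ, θ, hθ, ((hreg Φ hΦ).isFrame θ hθ).hasEigenvalue_shapeMatrix hc hx hcx⟩
      have h1 : ‖c‖ₑ ≤ K := le_iSup₂ (f := fun κ (_ : κ ∈ principalCurvatures k S ν) => ‖κ‖ₑ) c hmem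
      simpa using ENNReal.toReal_mono hKtop h1
    rw [norm_smul, Real.norm_eq_abs]
    gcongr

lemma isUnit_one_sub_smul_weingarten {ν : Amb m → Amb m}
    (hreg : ∀ Φ, IsChart k S Φ → IsRegularPatch (paramSet Φ) (param Φ) (ν ∘ param Φ))
    (hΦ : IsChart k S Φ) (hθ : θ ∈ paramSet Φ) {s : ℝ} (hs : ‖s‖ₑ < rhoBound k S ν) :
    IsUnit (1 - s • weingarten (param Φ) (ν ∘ param Φ) θ) := by
  obtain ⟨q, hq, h⟩ := exists_norm_smul_weingarten_le hreg (s₁ := ‖s‖₊) hs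
  exact isUnit_one_sub_of_norm_lt_one ((h Φ hΦ θ hθ s le_rfl).trans_lt hq)

lemma IsAdmissible.enorm_lt {ν : Amb m → Amb m} {ρ : Amb m → ℝ} (hρ : IsAdmissible k S ν ρ)
    {p : Amb m} (hp : p ∈ S) : ‖ρ p‖ₑ < rhoBound k S ν :=
  (le_iSup₂ (f := fun p (_ : p ∈ S) => ‖ρ p‖ₑ) p hp).trans_lt hρ.2

/-! ### The surface gradient is bounded -/

/-- The surface gradient in one chart is dominated by the one in any other chart. -/
lemma norm_tangentVec_grad_le {Φ' : Flattening m} {θ' : Par m} {ρ : Amb m → ℝ} (hk : k ≠ 0)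
    (hΦ : IsChart k S Φ) (hΦ' : IsChart k S Φ') (hθ : θ ∈ paramSet Φ) (hθ' : θ' ∈ paramSet Φ')
    (hρ : DifferentiableAt ℝ (ρ ∘ param Φ') θ') (hp : param Φ θ = param Φ' θ') :
    ‖tangentVec (param Φ) θ (grad (ρ ∘ param Φ) θ)‖ ≤
      ‖tangentVec (param Φ') θ' (grad (ρ ∘ param Φ') θ')‖ := by
  set T' := tangentVec (param Φ') θ' (grad (ρ ∘ param Φ') θ')
  set T := tangentVec (param Φ) θ (grad (ρ ∘ param Φ) θ) with hT
  have hmem : param Φ θ ∈ Φ'.source := hp ▸ param_mem_source hθ'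
  -- The transition map between the two charts.
  set H : Par m → Par m := fun η => (Φ' (param Φ η)).1
  have hHθ : H θ = θ' := by
    simp only [H, hp, apply_param hθ']
  have hφd := (hΦ.contDiffAt_param hθ).differentiableAt hk
  have hH : DifferentiableAt ℝ H θ :=
    (((hΦ'.contDiffAt hmem).differentiableAt hk).comp θ hφd).fst
  have hev : param Φ =ᶠ[𝓝 θ] param Φ' ∘ H := by
    filter_upwards [(isOpen_paramSet Φ).mem_nhds hθ,
      hφd.continuousAt.preimage_mem_nhds (Φ'.open_source.mem_nhds hmem)] with η hη hη'
    exact (hΦ'.param_fst hη' (hΦ.param_mem hη)).symm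
  have hφ'd : DifferentiableAt ℝ (param Φ') (H θ) :=
    hHθ ▸ (hΦ'.contDiffAt_param hθ').differentiableAt hk
  have hρ' : DifferentiableAt ℝ (ρ ∘ param Φ') (H θ) := hHθ ▸ hρ
  have hT' : ∀ w : Par m, ⟪T', fderiv ℝ (param Φ') θ' w⟫ = fderiv ℝ (ρ ∘ param Φ') θ' w := by
    intro w
    rw [← sum_smul_pd, ← sum_smul_pd, inner_sum]
    refine Finset.sum_congr rfl fun i _ => ?_
    rw [real_inner_smul_right, smul_eq_mul]
    congr 1
    exact inner_tangentVec_tau (hΦ'.linearIndependent_tau hk hθ') _ i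
  have hpd : ∀ i, ⟪T', tau (param Φ) i θ⟫ = grad (ρ ∘ param Φ) θ i := by
    intro i
    have hev' : ρ ∘ param Φ =ᶠ[𝓝 θ] (ρ ∘ param Φ') ∘ H := by
      filter_upwards [hev] with η hη
      simp only [Function.comp_apply] at hη ⊢
      rw [hη]
    rw [tau, pd_congr hev, grad, pd_congr hev', pd, pd, fderiv_comp θ hφ'd hH,
      fderiv_comp θ hρ' hH, hHθ]
    exact hT' _
  have hspan : ∀ x : Amb m, (∀ i, ⟪x, tau (param Φ) i θ⟫ = 0) → ⟪x, T⟫ = 0 := by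
    intro x hx
    simp only [hT, tangentVec, tauDual, inner_sum, real_inner_smul_right, hx, mul_zero,
      Finset.sum_const_zero]
  -- Both gradients have the same products with the `τᵢ`, so `T' - T` is orthogonal to `T`; thus
  -- `|T|² = (T' | T)` and Cauchy–Schwarz applies.
  have h0 := hspan (T' - T) fun i => by
    rw [inner_sub_left, hpd, hT, inner_tangentVec_tau (hΦ.linearIndependent_tau hk hθ), sub_self]
  rw [inner_sub_left, sub_eq_zero, real_inner_self_eq_norm_sq] at h0
  have hcs := real_inner_le_norm T' T
  by_contra! hlt
  nlinarith [norm_nonneg T', norm_nonneg T]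

lemma IsClosedHypersurface.exists_norm_tangentVec_grad_le (hS : IsClosedHypersurface k Ω S)
    {ν : Amb m → Amb m} (hk : k ≠ 0)
    (hreg : ∀ Φ, IsChart k S Φ → IsRegularPatch (paramSet Φ) (param Φ) (ν ∘ param Φ))
    {ρ : Amb m → ℝ} (hρ : IsC2On k S ρ) :
    ∃ R : ℝ≥0, ∀ Φ, IsChart k S Φ → ∀ θ ∈ paramSet Φ,
      ‖tangentVec (param Φ) θ (grad (ρ ∘ param Φ) θ)‖ ≤ R := by
  have hcpt : IsCompact S := by
    rw [← hS.frontier_eq]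
    exact Metric.isCompact_of_isClosed_isBounded isClosed_frontier
      (hS.isBounded.closure.subset frontier_subset_closure)
  suffices h : ∃ R : ℝ≥0, ∀ p ∈ S, ∀ Φ, IsChart k S Φ → ∀ θ ∈ paramSet Φ, param Φ θ = p →
      ‖tangentVec (param Φ) θ (grad (ρ ∘ param Φ) θ)‖ ≤ R by
    obtain ⟨R, hR⟩ := h
    exact ⟨R, fun Φ hΦ θ hθ => hR _ (hΦ.param_mem hθ) Φ hΦ θ hθ rfl⟩
  refine hcpt.induction_on
    (p := fun s => ∃ R : ℝ≥0, ∀ p ∈ s, ∀ Φ, IsChart k S Φ → ∀ θ ∈ paramSet Φ, param Φ θ = p →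
      ‖tangentVec (param Φ) θ (grad (ρ ∘ param Φ) θ)‖ ≤ R)
    ⟨0, fun p hp => hp.elim⟩ ?_ ?_ ?_
  · rintro s t hst ⟨R, hR⟩
    exact ⟨R, fun p hp => hR p (hst hp)⟩
  · rintro s t ⟨R, hR⟩ ⟨R', hR'⟩
    refine ⟨max R R', fun p hp Φ hΦ θ hθ hpθ => ?_⟩
    rcases hp with hp | hp
    · exact (hR p hp Φ hΦ θ hθ hpθ).trans (by exact_mod_cast le_max_left R R')
    · exact (hR' p hp Φ hΦ θ hθ hpθ).trans (by exact_mod_cast le_max_right R R')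
  · intro p hp
    obtain ⟨Φ₀, hΦ₀, hpΦ, -⟩ := hS.exists_chart p hp
    set θ₀ := (Φ₀ p).1
    have hθ₀ : θ₀ ∈ paramSet Φ₀ := hΦ₀.mk_fst_mem_target hpΦ hp
    set F : Par m → ℝ := fun η => ‖tangentVec (param Φ₀) η (grad (ρ ∘ param Φ₀) η)‖
    have hF : ContinuousAt F θ₀ := by
      have h1 := ContinuousAt.comp (f := fun η => (η, (0 : ℝ), grad (ρ ∘ param Φ₀) η))
        (x := θ₀) ((hreg Φ₀ hΦ₀).contDiffAt_tangentVec
          (x := (θ₀, (0 : ℝ), grad (ρ ∘ param Φ₀) θ₀)) hθ₀).continuousAt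
        (continuousAt_id.prodMk (continuousAt_const.prodMk
          ((hreg Φ₀ hΦ₀).contDiffAt_grad (hρ Φ₀ hΦ₀) hθ₀).continuousAt))
      exact h1.norm
    have hFp : ContinuousAt (fun x => F (Φ₀ x).1) p :=
      ContinuousAt.comp (f := fun x => (Φ₀ x).1) (g := F) hF (hΦ₀.contDiffAt hpΦ).continuousAt.fst
    have hlt : ∀ᶠ x in 𝓝 p, F (Φ₀ x).1 < F θ₀ + 1 :=
      hFp.eventually_lt continuousAt_const (lt_add_one _)
    -- Continuity in the single chart `Φ₀` bounds the gradient near `p`; comparison of charts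
    -- carries the bound to all others.
    refine ⟨S ∩ {x | x ∈ Φ₀.source ∧ F (Φ₀ x).1 < F θ₀ + 1}, ?_, (F θ₀ + 1).toNNReal, ?_⟩
    · exact Filter.inter_mem self_mem_nhdsWithin
        (mem_nhdsWithin_of_mem_nhds (Filter.inter_mem (Φ₀.open_source.mem_nhds hpΦ) hlt))
    · rintro x ⟨hxS, hxs, hxF⟩ Φ hΦ θ hθ hxθ
      have hmem := hΦ₀.mk_fst_mem_target hxs hxS
      have hd : DifferentiableAt ℝ (ρ ∘ param Φ₀) (Φ₀ x).1 :=
        ((hρ Φ₀ hΦ₀).contDiffAt ((isOpen_paramSet Φ₀).mem_nhds hmem)).differentiableAt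
          (by norm_num)
      have hle := norm_tangentVec_grad_le hk hΦ hΦ₀ hθ hmem hd
        (hxθ.trans (hΦ₀.param_fst hxs hxS).symm)
      exact hle.trans (hxF.le.trans (Real.le_coe_toNNReal _))

/-- Uniform ellipticity for bounded heights and gradients. -/
lemma exists_ellipticity {ν : Amb m → Amb m}
    (hreg : ∀ Φ, IsChart k S Φ → IsRegularPatch (paramSet Φ) (param Φ) (ν ∘ param Φ))
    (s₁ R : ℝ≥0) (hs : (s₁ : ℝ≥0∞) < rhoBound k S ν) :
    ∃ η : ℝ, 0 < η ∧ ∀ Φ : Flattening m, IsChart k S Φ → ∀ θ ∈ paramSet Φ,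
      ∀ (s : ℝ) (v : Fin m → ℝ), |s| ≤ s₁ → ‖tangentVec (param Φ) θ v‖ ≤ R →
      ∀ ξ : Fin m → ℝ,
        η * ‖tangentVec (param Φ) θ ξ‖ ^ 2 ≤
          ∑ i, ∑ j, coeff (param Φ) (ν ∘ param Φ) θ s v i j * ξ i * ξ j := by
  obtain ⟨q, hq, h⟩ := exists_norm_smul_weingarten_le hreg hs
  refine ⟨((1 + ((R : ℝ) / (1 - q)) ^ 2) ^ (-(1 / 2) : ℝ)) ^ 3 / 4, by positivity,
    fun Φ hΦ θ hθ s v hs₁ hv ξ => ?_⟩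
  exact ellipticity_of_norm_le ((hreg Φ hΦ).secondForm_symm hθ) hq (h Φ hΦ θ hθ s hs₁) hv ξ

end Hypersurf

/-! ### The main theorem. -/

theorem mainTheorem2 {m : ℕ} {k : WithTop ℕ∞} (hk : 3 ≤ k) {Ω S : Set (Amb m)}
    (hS : IsClosedHypersurface k Ω S) {ν : Amb m → Amb m} (hν : IsOuterNormal k Ω S ν) :
    -- the objects are well defined, and the curvature formula holds
    (∀ ρ : Amb m → ℝ, IsAdmissible k S ν ρ →
      ∀ Φ : Flattening m, IsChart k S Φ →
        ContDiffOn ℝ 2 (gammaParam (param Φ) (ν ∘ param Φ) (ρ ∘ param Φ)) (paramSet Φ) ∧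
        ContDiffOn ℝ 1 (aField (param Φ) (ν ∘ param Φ) (ρ ∘ param Φ)) (paramSet Φ) ∧
        ∀ θ ∈ paramSet Φ,
          IsUnit (1 - ρ (param Φ θ) • weingarten (param Φ) (ν ∘ param Φ) θ) ∧
          LinearIndependent ℝ
            (fun i => tau (gammaParam (param Φ) (ν ∘ param Φ) (ρ ∘ param Φ)) i θ) ∧
          (∃! w : Amb m, IsUnitNormalAt (gammaParam (param Φ) (ν ∘ param Φ) (ρ ∘ param Φ))
            (ν (param Φ θ)) θ w) ∧
          ∀ NΓ : Par m → Amb m,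
            IsUnitNormalAt (gammaParam (param Φ) (ν ∘ param Φ) (ρ ∘ param Φ))
              (ν (param Φ θ)) θ (NΓ θ) →
            meanCurvature (gammaParam (param Φ) (ν ∘ param Φ) (ρ ∘ param Φ)) NΓ θ
              = curvatureFormula (param Φ) (ν ∘ param Φ) (ρ ∘ param Φ) θ) ∧
    -- in each chart, `κ` is a quasilinear operator of second order
    (∀ Φ : Flattening m, IsChart k S Φ →
      (∀ i j, ContinuousOn
        (fun x : Par m × ℝ × (Fin m → ℝ) =>
          coeff (param Φ) (ν ∘ param Φ) x.1 x.2.1 x.2.2 i j)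
        {x | x.1 ∈ paramSet Φ ∧ ‖x.2.1‖ₑ < rhoBound k S ν}) ∧
      ∃ g : Par m × ℝ × (Fin m → ℝ) → ℝ,
        ContinuousOn g {x | x.1 ∈ paramSet Φ ∧ ‖x.2.1‖ₑ < rhoBound k S ν} ∧
        ∀ ρ : Amb m → ℝ, IsAdmissible k S ν ρ → ∀ θ ∈ paramSet Φ, ∀ NΓ : Par m → Amb m,
          IsUnitNormalAt (gammaParam (param Φ) (ν ∘ param Φ) (ρ ∘ param Φ))
            (ν (param Φ θ)) θ (NΓ θ) →
          meanCurvature (gammaParam (param Φ) (ν ∘ param Φ) (ρ ∘ param Φ)) NΓ θ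
            = (∑ i, ∑ j,
                coeff (param Φ) (ν ∘ param Φ) θ (ρ (param Φ θ)) (grad (ρ ∘ param Φ) θ) i j
                  * pd i (pd j (ρ ∘ param Φ)) θ)
              + g (θ, ρ (param Φ θ), grad (ρ ∘ param Φ) θ)) ∧
    -- strong ellipticity at each admissible `ρ`
    (∀ ρ : Amb m → ℝ, IsAdmissible k S ν ρ →
      ∃ η : ℝ, 0 < η ∧ ∀ Φ : Flattening m, IsChart k S Φ → ∀ θ ∈ paramSet Φ, ∀ ξ : Fin m → ℝ,
        η * ‖tangentVec (param Φ) θ ξ‖ ^ 2 ≤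
          ∑ i, ∑ j,
            coeff (param Φ) (ν ∘ param Φ) θ (ρ (param Φ θ)) (grad (ρ ∘ param Φ) θ) i j
              * ξ i * ξ j) ∧
    -- the ellipticity constant depends only on bounds for `|ρ|_∞` and `|∇ρ|_∞`
    (∀ (s₁ R : ℝ≥0), (s₁ : ℝ≥0∞) < rhoBound k S ν →
      ∃ η : ℝ, 0 < η ∧ ∀ Φ : Flattening m, IsChart k S Φ → ∀ θ ∈ paramSet Φ,
        ∀ (s : ℝ) (v : Fin m → ℝ), |s| ≤ s₁ → ‖tangentVec (param Φ) θ v‖ ≤ R →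
        ∀ ξ : Fin m → ℝ,
          η * ‖tangentVec (param Φ) θ ξ‖ ^ 2 ≤
            ∑ i, ∑ j, coeff (param Φ) (ν ∘ param Φ) θ s v i j * ξ i * ξ j) := by
  have hk0 : k ≠ 0 := by
    rintro rfl
    simp at hk
  have hreg : ∀ Φ, IsChart k S Φ → IsRegularPatch (paramSet Φ) (param Φ) (ν ∘ param Φ) :=
    fun Φ hΦ => hS.isRegularPatch hk hν hΦ
  refine ⟨fun ρ hρ Φ hΦ => ?_, fun Φ hΦ => ⟨fun i j x hx => ?_, ?_⟩, fun ρ hρ => ?_,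
    exists_ellipticity hreg⟩
  · have h := hreg Φ hΦ
    have hr := hρ.1 Φ hΦ
    have hA : ∀ η ∈ paramSet Φ,
        IsUnit (1 - (ρ ∘ param Φ) η • weingarten (param Φ) (ν ∘ param Φ) η) := fun η hη =>
      isUnit_one_sub_smul_weingarten hreg hΦ hη (hρ.enorm_lt (hΦ.param_mem hη))
    refine ⟨h.contDiffOn_gammaParam hr,
      fun θ hθ => (h.contDiffAt_aField hr hθ (hA θ hθ)).contDiffWithinAt, fun θ hθ => ?_⟩
    have hgt := h.hasGraphTangents hr hθ
    have hf := h.isFrame θ hθ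
    have hL := h.secondForm_symm hθ
    exact ⟨hA θ hθ, (hgt.isFrame hf hL (hA θ hθ)).linearIndependent,
      ⟨_, hgt.isUnitNormalAt hf hL (hA θ hθ), fun w hw =>
        hgt.eq_of_isUnitNormalAt hf hL (hA θ hθ) hw⟩,
      fun NΓ hN => h.meanCurvature_eq_curvatureFormula hr hA hθ hN⟩
  · exact ((hreg Φ hΦ).contDiffAt_coeff hx.1
      (isUnit_one_sub_smul_weingarten hreg hΦ hx.1 hx.2) i j).continuousAt.continuousWithinAt
  · refine ⟨_, fun x hx => ((hreg Φ hΦ).continuousAt_lowerOrder hx.1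
      (isUnit_one_sub_smul_weingarten hreg hΦ hx.1 hx.2)).continuousWithinAt, ?_⟩
    intro ρ hρ θ hθ NΓ hN
    exact (hreg Φ hΦ).meanCurvature_gammaParam (hρ.1 Φ hΦ) hθ
      (isUnit_one_sub_smul_weingarten hreg hΦ hθ (hρ.enorm_lt (hΦ.param_mem hθ))) hN
  · obtain ⟨R, hR⟩ := hS.exists_norm_tangentVec_grad_le hk0 hreg hρ.1
    have htop : supNorm S ρ ≠ ⊤ := ne_top_of_lt hρ.2
    -- The supremum norm of `ρ` is itself an allowed height bound, since admissibility is strict.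
    obtain ⟨η, hη, h⟩ := exists_ellipticity hreg (supNorm S ρ).toNNReal R
      (by rw [ENNReal.coe_toNNReal htop]; exact hρ.2)
    refine ⟨η, hη, fun Φ hΦ θ hθ ξ => h Φ hΦ θ hθ _ _ ?_ (hR Φ hΦ θ hθ) ξ⟩
    have hle : ‖ρ (param Φ θ)‖ₑ ≤ supNorm S ρ :=
      le_iSup₂ (f := fun p (_ : p ∈ S) => ‖ρ p‖ₑ) _ (hΦ.param_mem hθ)
    have h1 := ENNReal.toReal_mono htop hle
    rwa [toReal_enorm, Real.norm_eq_abs] at h1
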